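/- Let $1<A<B$, $E=[-1,1]$ and $D=\widehat{\mathbb C}\setminus E$. Let $\varphi(\zeta)=\zeta+(\zeta^2-1)^{1/2}$, where the branch on $D$ is chosen so that $\varphi(\zeta)\sim 2\zeta$ as $\zeta\to\infty$, and put $1/\varphi(\infty)=0$. Let $$f_*(\zeta)=\Bigl[\Bigl(A-\frac1{\varphi(\zeta)}\Bigr)\Bigl(B-\frac1{\varphi(\zeta)}\Bigr)\Bigr]^{-1/2},\qquad \zeta\in D,$$ with the branch for which $f_*(\infty)=1/\sqrt{AB}$, and let $f(z)=f_*(1/z)$, which is holomorphic near $z=0$. For each $n\ge 0$ let $P_n,Q_n$ be polynomials (over $\mathbb C$) of degree at most $n$ with $Q_n\not\equiv 0$ and $Q_n(z)f(z)-P_n(z)=O(z^{2n+1})$ as $z\to0$, so that $[n/n]_f=P_n/Q_n$ is the diagonal Padé approximant of $f$, and set $p_n(\zeta)=\zeta^nP_n(1/\zeta)$, $q_n(\zeta)=\zeta^nQ_n(1/\zeta)$ and $N=2n+1$. For a polynomial $p\not\equiv0$ let $\chi(p)=\sum_{p(\eta)=0}\delta_\eta$, the zeros being counted with multiplicity. Let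 $d\tau_E(x)=\dfrac{dx}{\pi\sqrt{1-x^2}}$ on $[-1,1]$, and let $g_D(\zeta,\infty)=\log|\varphi(\zeta)|$ for finite $\zeta\in D$, with $e^{-g_D(\infty,\infty)}=0$. Then the following hold. 1. For some constant $\gamma_E$, $\tau_E$ is a Robin (equilibrium) measure of $E$ with Robin constant $\gamma_E$, that is, it is a probability measure on $E$ with $\int\log\frac1{|x-t|}\,d\tau_E(t)=\gamma_E$ (an absolutely convergent integral) for every $x\in E$; and $g_D(\cdot,\infty)$ is Green's function of $D$ with pole at infinity, that is, it is harmonic in $\mathbb C\setminus E$, equals $\log|\zeta|+\gamma_E+o(1)$ as $\zeta\to\infty$, and tends to $0$ at every point of $E$. 2. As $n\to\infty$, $\frac1n\chi(p_n)\to\tau_E$ and $\frac1n\chi(q_n)\to\tau_E$ weakly-$*$ (tested on bounded continuous functions on $\mathbb C$). 3. For every compact set $K\subset D$ (possibly containing $\infty$) the function $[n/n]_f(1/\zeta)$ has no poles on $K$ for all large $n$ (indeed $Q_n(1/\zeta)\ne0$ for $\zeta\in K$), and $$\bigl|f_*(\zeta)-[n/n]_f(1/\zeta)\bigr|^{1/N}\to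 e^{-g_D(\zeta,\infty)}\qquad (n\to\infty)$$ uniformly on $K$. Moreover $e^{-g_D(\zeta,\infty)}<1$ for every $\zeta\in D$. -/

import Mathlib

open scoped Polynomial Topology BoundedContinuousFunction

noncomputable section

namespace PadeModel

/-- The segment `E = [-1, 1]`, as a subset of the complex plane. -/
def E : Set ℂ := Complex.ofReal '' Set.Icc (-1) 1

/-- The domain `D`, the complement of `E` in the Riemann sphere (it contains `∞`). -/
def D : Set (OnePoint ℂ) := ((fun ζ : ℂ => (ζ : OnePoint ℂ)) '' E)ᶜ

/-- `φ(ζ) = ζ + (ζ² - 1)^{1/2}` with the branch `φ(ζ) ∼ 2ζ` at infinity. The product of the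
principal roots of `ζ - 1` and `ζ + 1` is the branch of `(ζ² - 1)^{1/2}` that is holomorphic
off `[-1, 1]` and equivalent to `ζ` at infinity: the sign changes of the two factors on
`(-∞, -1)` cancel. -/
def phi (ζ : ℂ) : ℂ := ζ + (ζ - 1) ^ (1 / 2 : ℂ) * (ζ + 1) ^ (1 / 2 : ℂ)

/-- `1 / φ` on the Riemann sphere, with value `0` at infinity. -/
def invPhi (ζ : OnePoint ℂ) : ℂ := OnePoint.elim ζ 0 (fun ξ : ℂ => 1 / phi ξ)

/-- The model function `f_*(ζ) = [(A - 1/φ(ζ)) (B - 1/φ(ζ))]^{-1/2}` on the Riemann sphere.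
For `1 < A < B` and `ζ ∈ D` one has `|1/φ(ζ)| < 1`, both factors lie in the right half-plane
and their product avoids `(-∞, 0]`: the principal power is the holomorphic branch with
`f_*(∞) = 1/√(AB)`. -/
def fStar (A B : ℝ) (ζ : OnePoint ℂ) : ℂ :=
  (((A : ℂ) - invPhi ζ) * ((B : ℂ) - invPhi ζ)) ^ (-(1 / 2) : ℂ)

/-- `z ↦ 1/z` from the plane to the Riemann sphere, with `0 ↦ ∞`. -/
def recip (z : ℂ) : OnePoint ℂ := open Classical in if z = 0 then OnePoint.infty else ↑(z⁻¹)

/-- `ζ ↦ 1/ζ` from the Riemann sphere minus the origin to the plane, with `∞ ↦ 0`. -/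
def coord (ζ : OnePoint ℂ) : ℂ := OnePoint.elim ζ 0 (fun ξ : ℂ => ξ⁻¹)

/-- The germ `f(z) = f_*(1/z)` at the origin. -/
def germ (A B : ℝ) (z : ℂ) : ℂ := fStar A B (recip z)

/-- `(P, Q)` is a pair of diagonal Padé polynomials of order `n` of `f` at the origin:
`Q ≢ 0`, `deg P ≤ n`, `deg Q ≤ n` and `(Q f - P)(z) = O(z^{2n+1})` as `z → 0`. -/
def IsPadePair (f : ℂ → ℂ) (n : ℕ) (P Q : ℂ[X]) : Prop :=
  Q ≠ 0 ∧ P.natDegree ≤ n ∧ Q.natDegree ≤ n ∧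
    (fun z : ℂ => Q.eval z * f z - P.eval z) =O[𝓝 0] (fun z : ℂ => z ^ (2 * n + 1))

/-- The zero-counting measure `χ(p)`: the sum of the unit point masses at the zeros of `p`,
counted with multiplicity. -/
def zeroCount (p : ℂ[X]) : MeasureTheory.Measure ℂ :=
  (p.roots.map (fun η : ℂ => MeasureTheory.Measure.dirac η)).sum

/-- Weak-* convergence of measures on the plane, tested on bounded continuous functions. -/
def WeakStarTendsto (μ : ℕ → MeasureTheory.Measure ℂ) (τ : MeasureTheory.Measure ℂ) : Prop :=
  ∀ h : ℂ →ᵇ ℝ,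
    Filter.Tendsto (fun n => ∫ t, h t ∂(μ n)) Filter.atTop (𝓝 (∫ t, h t ∂τ))

/-- The arcsine measure `dx / (π √(1 - x²))` on `[-1, 1]`, as a measure on the plane. -/
def arcsine : MeasureTheory.Measure ℂ :=
  ((MeasureTheory.volume.restrict (Set.Icc (-1 : ℝ) 1)).withDensity
    (fun x => ENNReal.ofReal (1 / (Real.pi * Real.sqrt (1 - x ^ 2))))).map Complex.ofReal

/-- The logarithmic potential `V^μ(ζ) = ∫ log (1/|ζ - t|) dμ(t)`. -/
def logPotential (μ : MeasureTheory.Measure ℂ) (ζ : ℂ) : ℝ :=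
  ∫ t, Real.log (1 / ‖ζ - t‖) ∂μ

/-- `μ` is the Robin (equilibrium) measure of the compact set `K`, with Robin constant `γ`:
a probability measure on `K` whose potential is finite and equal to `γ` at all points of `K`.
(Where `μ` has no atom, the value of the logarithm at `t = x` does not matter.) -/
structure IsRobinMeasure (K : Set ℂ) (μ : MeasureTheory.Measure ℂ) (γ : ℝ) : Prop where
  isProbabilityMeasure : MeasureTheory.IsProbabilityMeasure μ
  measure_compl : μ Kᶜ = 0
  noAtom : ∀ x ∈ K, μ {x} = 0
  integrable : ∀ x ∈ K, MeasureTheory.Integrable (fun t => Real.log (1 / ‖x - t‖)) μ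
  potential_eq : ∀ x ∈ K, logPotential μ x = γ

/-- `g` is Green's function, with logarithmic singularity at infinity, of the complement of the
compact set `K` in the Riemann sphere: it is harmonic off `K`, equals `log |ζ| + γ + o(1)` at
infinity and has boundary values `0`. -/
structure IsGreenFunction (K : Set ℂ) (g : ℂ → ℝ) (γ : ℝ) : Prop where
  harmonic : InnerProductSpace.HarmonicOnNhd g Kᶜ
  infinity : Filter.Tendsto (fun ζ => g ζ - Real.log ‖ζ‖) (Filter.cocompact ℂ) (𝓝 γ)
  boundary : ∀ x ∈ frontier K, Filter.Tendsto g (𝓝[Kᶜ] x) (𝓝 0)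

/-- Green's function `g_D(ζ, ∞) = log |φ(ζ)|` of the domain `D`, at finite points. -/
def green (ζ : ℂ) : ℝ := Real.log ‖phi ζ‖

/-- `e^{-g_D(ζ, ∞)}` on the Riemann sphere; it is `0` at infinity, where `g_D = +∞`. -/
def expNegGreen (ζ : OnePoint ℂ) : ℝ := OnePoint.elim ζ 0 (fun ξ : ℂ => Real.exp (-green ξ))

end PadeModel

end

/-! ### The Joukowski inverse `phi`: modulus, boundary values and analyticity off `E`. -/

noncomputable section
namespace PadeModel
open Complex Filter

/-! In the coordinate `w = 1/φ(ζ)`, where `2ζ = w + 1/w`, the model function becomes `F(w) = ((A -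
w)(B - w))^{-1/2}`, holomorphic on the closed unit disc and real on the real axis. On the unit
circle `F(s) - F(1/s) = 2i Im F(s) = 2i (Im s) k(s)` with `k > 0`, so Cauchy's formula exhibits `f_*
- F(0)` as the Markov function of a positive measure `σ` on `[-1, 1]`
(`HasPositiveJump.sub_eq_sig`). The reflected Padé denominators `q` are then the orthogonal
polynomials of `σ`, and with `p` the reflected numerator, `q (q f_* - p)` is the Cauchy transform of
`q² σ` (`IsPadePair.orthogonality`, `IsPadePair.eval_mul_remainder`).

The central object is `joukProd`, which equals `(2w)ⁿ q(ζ)` divided by the leading coefficient: a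
polynomial in `w` with value 1 at 0. Comparison with the Chebyshev polynomial bounds the minimal
norm of `q`, and this bounds `joukProd` locally uniformly in the disc, independently of `n`
(`exists_norm_joukProd_le`). Its zeros lie off the open disc because those of `q` lie in `E`, so it
has a logarithm vanishing at 0, which Borel–Carathéodory bounds as well (`exists_norm_logProd_le`).

Both limit statements follow. The Taylor coefficients of the logarithm are `-(2/m) ∑ T_m(η)` over
the zeros `η`, so each Chebyshev sum with `m ≥ 1` stays bounded; after division by `n` it tends to
`0 = ∫ T_m dτ_E`, and the Chebyshev polynomials span all polynomials. The two-sided bounds on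
`joukProd`, with no cancellation in the Cauchy transform of `|q|² σ`, trap the error between
multiples of `|w|^{2n+1}` (`exists_remainder_bounds`). The numerators need no separate theory: they
are the denominators for `-1/f`, whose jump is again positive (`hasPositiveJump_neg_inv`,
`IsPadePair.neg_inv`). -/

theorem sqrt_mul_self (z : ℂ) : z ^ (1 / 2 : ℂ) * z ^ (1 / 2 : ℂ) = z := by
  have := Complex.cpow_nat_inv_pow z (n := 2) two_ne_zero
  rw [← sq]; convert this using 2; norm_num

theorem ofReal_mem_E {x : ℝ} : (x : ℂ) ∈ E ↔ -1 ≤ x ∧ x ≤ 1 := by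
  constructor
  · rintro ⟨y, hy, h⟩
    have : y = x := Complex.ofReal_injective h
    exact this ▸ hy
  · intro h; exact ⟨x, h, rfl⟩

theorem isCompact_E : IsCompact E := isCompact_Icc.image Complex.continuous_ofReal

theorem phi_eq (z : ℂ) :
    phi z = ((z - 1) ^ (1 / 2 : ℂ) + (z + 1) ^ (1 / 2 : ℂ)) ^ 2 / 2 := by
  have h1 := sqrt_mul_self (z - 1)
  have h2 := sqrt_mul_self (z + 1)
  unfold phi
  linear_combination (-1 / 2 : ℂ) * h1 - (1 / 2 : ℂ) * h2

theorem phi_mul (z : ℂ) :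
    phi z * (((z + 1) ^ (1 / 2 : ℂ) - (z - 1) ^ (1 / 2 : ℂ)) ^ 2 / 2) = 1 := by
  have h1 := sqrt_mul_self (z - 1)
  have h2 := sqrt_mul_self (z + 1)
  rw [phi_eq]
  set s := (z - 1) ^ (1 / 2 : ℂ)
  set t := (z + 1) ^ (1 / 2 : ℂ)
  have : t * t - s * s = 2 := by rw [h1, h2]; ring
  linear_combination (t * t - s * s + 2) / 4 * this

theorem phi_ne_zero (z : ℂ) : phi z ≠ 0 := fun h => by simpa [h] using phi_mul z

theorem inv_phi_eq (z : ℂ) :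
    (phi z)⁻¹ = ((z + 1) ^ (1 / 2 : ℂ) - (z - 1) ^ (1 / 2 : ℂ)) ^ 2 / 2 :=
  (eq_inv_of_mul_eq_one_right (phi_mul z)).symm

/-- `φ` inverts the Joukowski map. -/
theorem phi_add_inv (z : ℂ) : phi z + (phi z)⁻¹ = 2 * z := by
  have h1 := sqrt_mul_self (z - 1)
  have h2 := sqrt_mul_self (z + 1)
  rw [inv_phi_eq, phi_eq]
  linear_combination h1 + h2

/-- Parallelogram law for the two roots. It makes the modulus of `phi` a function of the sum of
distances to the foci, hence continuous even across the cut, where `phi` itself jumps. -/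
theorem norm_phi_add_inv (z : ℂ) : ‖phi z‖ + ‖phi z‖⁻¹ = ‖z - 1‖ + ‖z + 1‖ := by
  rw [← norm_inv, inv_phi_eq, phi_eq]
  have h1 := sqrt_mul_self (z - 1)
  have h2 := sqrt_mul_self (z + 1)
  set s := (z - 1) ^ (1 / 2 : ℂ)
  set t := (z + 1) ^ (1 / 2 : ℂ)
  rw [← h1, ← h2]
  have := parallelogram_law_with_norm ℝ t s
  simp only [norm_div, norm_pow, norm_mul, Complex.norm_ofNat]
  rw [add_comm s t]
  linarith

theorem re_sqrt_nonneg (z : ℂ) : 0 ≤ (z ^ (1 / 2 : ℂ)).re := by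
  by_cases hz : z = 0
  · simp [hz]
  have : z ^ (1 / 2 : ℂ) = z ^ ((1 / 2 : ℝ) : ℂ) := by norm_num
  rw [this, Complex.cpow_ofReal_re]
  have h1 := Complex.neg_pi_lt_arg z
  have h2 := Complex.arg_le_pi z
  apply mul_nonneg (by positivity)
  apply Real.cos_nonneg_of_mem_Icc
  constructor <;> linarith

theorem two_re_mul_im_sqrt (z : ℂ) :
    2 * ((z ^ (1 / 2 : ℂ)).re * (z ^ (1 / 2 : ℂ)).im) = z.im := by
  have := congrArg Complex.im (sqrt_mul_self z)
  simp only [Complex.mul_im] at this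
  linarith

theorem re_sq_sub_im_sq_sqrt (z : ℂ) :
    (z ^ (1 / 2 : ℂ)).re ^ 2 - (z ^ (1 / 2 : ℂ)).im ^ 2 = z.re := by
  have := congrArg Complex.re (sqrt_mul_self z)
  simp only [Complex.mul_re] at this
  linarith

theorem im_sqrt_nonneg_of_im_eq_zero {z : ℂ} (h : z.im = 0) : 0 ≤ (z ^ (1 / 2 : ℂ)).im := by
  have hz : z ^ (1 / 2 : ℂ) = z ^ ((1 / 2 : ℝ) : ℂ) := by norm_num
  rw [hz, Complex.cpow_ofReal_im]
  have : 0 ≤ z.arg := Complex.arg_nonneg_iff.2 h.ge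
  have h2 := Complex.arg_le_pi z
  apply mul_nonneg (by positivity)
  apply Real.sin_nonneg_of_mem_Icc
  constructor <;> linarith

/-- Both principal roots lie in the closed right half-plane, and their imaginary parts share the
sign of `z.im`. The quantity is half of `‖phi z‖ - ‖(phi z)⁻¹‖`, so its sign decides whether `phi`
maps outside the unit disc. -/
theorem re_sqrt_mul_conj_nonneg (z : ℂ) :
    0 ≤ ((z + 1) ^ (1 / 2 : ℂ)).re * ((z - 1) ^ (1 / 2 : ℂ)).re +
      ((z + 1) ^ (1 / 2 : ℂ)).im * ((z - 1) ^ (1 / 2 : ℂ)).im := by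
  have a1 := re_sqrt_nonneg (z + 1)
  have a2 := re_sqrt_nonneg (z - 1)
  have b1 := two_re_mul_im_sqrt (z + 1)
  have b2 := two_re_mul_im_sqrt (z - 1)
  simp only [add_im, sub_im, one_im, add_zero, sub_zero] at b1 b2
  refine add_nonneg (mul_nonneg a1 a2) ?_
  rcases lt_trichotomy z.im 0 with h | h | h
  · exact mul_nonneg_of_nonpos_of_nonpos (by nlinarith) (by nlinarith)
  · exact mul_nonneg (im_sqrt_nonneg_of_im_eq_zero (by simpa using h))
      (im_sqrt_nonneg_of_im_eq_zero (by simpa using h))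
  · exact mul_nonneg (by nlinarith) (by nlinarith)

theorem re_sqrt_mul_conj_pos {z : ℂ} (hz : z ∉ E) :
    0 < ((z + 1) ^ (1 / 2 : ℂ)).re * ((z - 1) ^ (1 / 2 : ℂ)).re +
      ((z + 1) ^ (1 / 2 : ℂ)).im * ((z - 1) ^ (1 / 2 : ℂ)).im := by
  refine lt_of_le_of_ne (re_sqrt_mul_conj_nonneg z) fun h0 => ?_
  have a1 := re_sqrt_nonneg (z + 1)
  have a2 := re_sqrt_nonneg (z - 1)
  have b1 := two_re_mul_im_sqrt (z + 1)
  have b2 := two_re_mul_im_sqrt (z - 1)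
  have c1 := re_sq_sub_im_sq_sqrt (z + 1)
  have c2 := re_sq_sub_im_sq_sqrt (z - 1)
  have d1 := fun h => @im_sqrt_nonneg_of_im_eq_zero (z + 1) h
  have d2 := fun h => @im_sqrt_nonneg_of_im_eq_zero (z - 1) h
  simp only [add_im, sub_im, one_im, add_zero, sub_zero, add_re, sub_re, one_re]
      at b1 b2 c1 c2 d1 d2
  generalize ((z + 1) ^ (1 / 2 : ℂ)).re = t at *
  generalize ((z + 1) ^ (1 / 2 : ℂ)).im = t' at *
  generalize ((z - 1) ^ (1 / 2 : ℂ)).re = s at *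
  generalize ((z - 1) ^ (1 / 2 : ℂ)).im = s' at *
  -- Off the real axis, equality would force `z.im ^ 2 = -4 (t s)²`, which is impossible.
  have him : z.im = 0 := by
    by_contra him
    have hp : 0 < z.im ^ 2 := by positivity
    have : z.im ^ 2 = 4 * ((t * s) * (t' * s')) :=
      calc z.im ^ 2 = (2 * (t * t')) * (2 * (s * s')) := by rw [b1, b2]; ring
        _ = _ := by ring
    have h2 : t' * s' = -(t * s) := by linarith
    rw [h2] at this
    nlinarith [sq_nonneg (t * s)]
  have hzr : z = (z.re : ℂ) := by apply Complex.ext <;> simp [him]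
  rw [hzr, ofReal_mem_E, not_and_or, not_le, not_le] at hz
  specialize d1 him
  specialize d2 him
  have e1 : t * s = 0 := by nlinarith [mul_nonneg a1 a2, mul_nonneg d1 d2]
  have e2 : t' * s' = 0 := by nlinarith [mul_nonneg a1 a2, mul_nonneg d1 d2]
  -- For real `z` the left side is `(z + 1)(z - 1)`, so `z` would lie in `[-1, 1]`.
  have e : (t ^ 2 - t' ^ 2) * (s ^ 2 - s' ^ 2) ≤ 0 := by
    nlinarith [sq_nonneg (t * s'), sq_nonneg (t' * s), congrArg (· ^ 2) e1, congrArg (· ^ 2) e2]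
  rw [c1, c2] at e
  rcases hz with hz | hz <;> nlinarith

theorem sq_norm_sqrt_add_sub (z : ℂ) :
    ‖phi z‖ - ‖(phi z)⁻¹‖ = 2 * (((z + 1) ^ (1 / 2 : ℂ)).re * ((z - 1) ^ (1 / 2 : ℂ)).re +
      ((z + 1) ^ (1 / 2 : ℂ)).im * ((z - 1) ^ (1 / 2 : ℂ)).im) := by
  rw [inv_phi_eq, phi_eq]
  simp only [norm_div, norm_pow, Complex.norm_ofNat, Complex.sq_norm, Complex.normSq_apply,
    add_re, add_im, sub_re, sub_im]
  ring

theorem one_le_norm_phi (z : ℂ) : 1 ≤ ‖phi z‖ := by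
  have h := sq_norm_sqrt_add_sub z
  have h2 := re_sqrt_mul_conj_nonneg z
  by_contra! hlt
  have hp : 0 < ‖phi z‖ := norm_pos_iff.2 (phi_ne_zero z)
  have := (one_lt_inv₀ hp).2 hlt
  rw [norm_inv] at h
  linarith

theorem one_lt_norm_phi {z : ℂ} (hz : z ∉ E) : 1 < ‖phi z‖ := by
  have h := sq_norm_sqrt_add_sub z
  have h2 := re_sqrt_mul_conj_pos hz
  by_contra! hlt
  have hp : 0 < ‖phi z‖ := norm_pos_iff.2 (phi_ne_zero z)
  have := (one_le_inv₀ hp).2 hlt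
  rw [norm_inv] at h
  linarith

theorem norm_phi_eq (z : ℂ) :
    ‖phi z‖ = (‖z - 1‖ + ‖z + 1‖) / 2 + √(((‖z - 1‖ + ‖z + 1‖) / 2) ^ 2 - 1) := by
  have h := norm_phi_add_inv z
  have h1 := one_le_norm_phi z
  have hp : 0 < ‖phi z‖ := norm_pos_iff.2 (phi_ne_zero z)
  rw [← h]
  set a := ‖phi z‖
  have hi : a⁻¹ ≤ 1 := inv_le_one_of_one_le₀ h1
  have : ((a + a⁻¹) / 2) ^ 2 - 1 = ((a - a⁻¹) / 2) ^ 2 := by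
    field_simp
    ring
  rw [this, Real.sqrt_sq (by linarith)]
  ring

theorem continuous_norm_phi : Continuous fun z => ‖phi z‖ := by
  simp only [norm_phi_eq]
  fun_prop

theorem norm_phi_of_mem_E {z : ℂ} (hz : z ∈ E) : ‖phi z‖ = 1 := by
  obtain ⟨x, ⟨h1, h2⟩, rfl⟩ := hz
  have e1 : ‖(x : ℂ) - 1‖ = 1 - x := by
    rw [show (x : ℂ) - 1 = ((x - 1 : ℝ) : ℂ) by push_cast; rfl, Complex.norm_real, Real.norm_eq_abs,
      abs_of_nonpos (by linarith)]
    ring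
  have e2 : ‖(x : ℂ) + 1‖ = x + 1 := by
    rw [show (x : ℂ) + 1 = ((x + 1 : ℝ) : ℂ) by push_cast; rfl, Complex.norm_real, Real.norm_eq_abs,
      abs_of_nonneg (by linarith)]
  rw [norm_phi_eq, e1, e2]
  norm_num [show (1 - x + (x + 1)) / 2 = 1 by ring]

theorem norm_le_norm_phi (z : ℂ) : ‖z‖ ≤ ‖phi z‖ := by
  rw [norm_phi_eq]
  have : ‖(2 : ℂ) * z‖ ≤ ‖z - 1‖ + ‖z + 1‖ := by
    rw [show 2 * z = (z - 1) + (z + 1) by ring]; exact norm_add_le _ _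
  rw [norm_mul, Complex.norm_ofNat] at this
  have := Real.sqrt_nonneg (((‖z - 1‖ + ‖z + 1‖) / 2) ^ 2 - 1)
  linarith

theorem zero_mem_E : (0 : ℂ) ∈ E := ⟨0, by norm_num, by simp⟩

/-- A nonpositive value would make `z²` a real number in `(0, 1]`. -/
theorem one_sub_inv_sq_mem_slitPlane {z : ℂ} (hz : z ∉ E) : 1 - (z ^ 2)⁻¹ ∈ slitPlane := by
  by_contra h
  rw [Complex.mem_slitPlane_iff, not_or, not_lt, not_not] at h
  obtain ⟨h1, h2⟩ := h
  have hz0 : z ≠ 0 := fun h => hz (h ▸ zero_mem_E)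
  set u := 1 - (z ^ 2)⁻¹ with hu
  have hur : u = (u.re : ℂ) := by apply Complex.ext <;> simp [h2]
  have hzz : z ^ 2 = (((1 - u.re)⁻¹ : ℝ) : ℂ) := by
    push_cast
    rw [← hur, hu]
    simp
  have hpos : 0 < 1 - u.re := by linarith
  have him := congrArg Complex.im hzz
  have hre := congrArg Complex.re hzz
  simp only [sq, Complex.mul_im, Complex.mul_re, ofReal_im, ofReal_re] at him hre
  have hle : (1 - u.re)⁻¹ ≤ 1 := inv_le_one_of_one_le₀ (by linarith)
  have hp : 0 < (1 - u.re)⁻¹ := by positivity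
  have hzi : z.im = 0 := by
    by_contra hne
    have : z.re = 0 := by
      have : z.re * z.im = 0 := by linarith
      exact (mul_eq_zero.1 this).resolve_right hne
    rw [this] at hre
    nlinarith [mul_self_nonneg z.im]
  have hzr : z = (z.re : ℂ) := by apply Complex.ext <;> simp [hzi]
  rw [hzi] at hre
  rw [hzr] at hz
  exact hz (ofReal_mem_E.2 (abs_le.1 (abs_le_one_iff_mul_self_le_one.2 (by linarith))))

/-- The branch of `(z² - 1)^{1/2}` in the definition of `φ`, with a single principal root. -/
theorem sqrt_mul_sqrt_eq {z : ℂ} (hz : z ∉ E) :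
    (z - 1) ^ (1 / 2 : ℂ) * (z + 1) ^ (1 / 2 : ℂ) = z * (1 - (z ^ 2)⁻¹) ^ (1 / 2 : ℂ) := by
  have hz0 : z ≠ 0 := fun h => hz (h ▸ zero_mem_E)
  have hpos := re_sqrt_mul_conj_pos hz
  have h1 := sqrt_mul_self (z - 1)
  have h2 := sqrt_mul_self (z + 1)
  have h3 := sqrt_mul_self (1 - (z ^ 2)⁻¹)
  have hr := re_sqrt_nonneg (1 - (z ^ 2)⁻¹)
  set s := (z - 1) ^ (1 / 2 : ℂ)
  set t := (z + 1) ^ (1 / 2 : ℂ)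
  set v := (1 - (z ^ 2)⁻¹) ^ (1 / 2 : ℂ)
  have hsq : (s * t) ^ 2 = (z * v) ^ 2 := by
    have : z ^ 2 * (z ^ 2)⁻¹ = 1 := mul_inv_cancel₀ (pow_ne_zero _ hz0)
    linear_combination (t * t) * h1 + (z - 1) * h2 - z ^ 2 * h3 + this
  rcases sq_eq_sq_iff_eq_or_eq_neg.1 hsq with h | h
  · exact h
  exfalso
  have hzst : 2 * z = s * s + t * t := by rw [h1, h2]; ring
  -- The two branches agree up to sign. Since `2z = s² + t²`, this real part is positive; the
  -- opposite sign would make it `-|z|² Re v ≤ 0`.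
  have key : 2 * (s * t * (starRingEnd ℂ) z).re =
      (normSq s + normSq t) * (t.re * s.re + t.im * s.im) := by
    have := congrArg (fun u : ℂ => (s * t * (starRingEnd ℂ) u).re) hzst
    simp only [map_mul, map_add, map_ofNat] at this
    have e : (s * t * (2 * (starRingEnd ℂ) z)).re = 2 * (s * t * (starRingEnd ℂ) z).re := by
      rw [show s * t * (2 * (starRingEnd ℂ) z) = ((2 : ℝ) : ℂ) * (s * t * (starRingEnd ℂ) z) by
        push_cast; ring, Complex.re_ofReal_mul]
    rw [← e, this]
    simp only [mul_re, mul_im, add_re, add_im, conj_re, conj_im, normSq_apply]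
    ring
  have hst : s ≠ 0 ∨ t ≠ 0 := by
    by_contra! hc
    rw [hc.1, hc.2] at hpos
    simp at hpos
  have hn : 0 < normSq s + normSq t := by
    rcases hst with h | h
    · have := normSq_pos.2 h; have := normSq_nonneg t; linarith
    · have := normSq_pos.2 h; have := normSq_nonneg s; linarith
  have hneg : (s * t * (starRingEnd ℂ) z).re = -(normSq z * v.re) := by
    rw [h, show -(z * v) * (starRingEnd ℂ) z = -((z * (starRingEnd ℂ) z) * v) by ring,
      Complex.mul_conj, neg_re, Complex.re_ofReal_mul]
  have := mul_pos hn hpos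
  rw [← key, hneg] at this
  nlinarith [mul_nonneg (normSq_nonneg z) hr]

theorem phi_eq_of_notMem {z : ℂ} (hz : z ∉ E) :
    phi z = z + z * (1 - (z ^ 2)⁻¹) ^ (1 / 2 : ℂ) := by
  rw [phi, sqrt_mul_sqrt_eq hz]

theorem analyticAt_phi {z : ℂ} (hz : z ∉ E) : AnalyticAt ℂ phi z := by
  have hz0 : z ≠ 0 := fun h => hz (h ▸ zero_mem_E)
  have h1 : AnalyticAt ℂ (fun z : ℂ => z + z * (1 - (z ^ 2)⁻¹) ^ (1 / 2 : ℂ)) z := by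
    have : AnalyticAt ℂ (fun z : ℂ => 1 - (z ^ 2)⁻¹) z :=
      analyticAt_const.sub ((analyticAt_id.pow 2).inv (pow_ne_zero _ hz0))
    exact analyticAt_id.add (analyticAt_id.mul
      (this.cpow analyticAt_const (one_sub_inv_sq_mem_slitPlane hz)))
  refine h1.congr ?_
  filter_upwards [isCompact_E.isClosed.isOpen_compl.mem_nhds hz] with y hy
  exact (phi_eq_of_notMem hy).symm

end PadeModel
end

/-! ### The arcsine measure as equilibrium measure, and Green's function. -/

noncomputable section
namespace PadeModel
open Complex Filter MeasureTheory Metric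

theorem arcsine_eq_map_measureT :
    arcsine = ((ENNReal.ofReal (1 / Real.pi)) • Polynomial.Chebyshev.measureT).map
      Complex.ofReal := by
  unfold arcsine
  congr 1
  have hm : Measurable fun x : ℝ => ENNReal.ofNNReal (.mk (√(1 - x ^ 2)⁻¹) (by positivity)) := by
    fun_prop
  rw [Polynomial.Chebyshev.measureT, restrict_withDensity measurableSet_Ioc,
    Measure.restrict_congr_set Ioc_ae_eq_Icc, ← withDensity_smul _ hm]
  congr 1
  ext x
  have : ENNReal.ofNNReal (.mk (√(1 - x ^ 2)⁻¹) (by positivity)) =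
      ENNReal.ofReal (√(1 - x ^ 2)⁻¹) := by
    rw [ENNReal.ofReal, Real.toNNReal_of_nonneg (Real.sqrt_nonneg _)]
  rw [Pi.smul_apply, smul_eq_mul, this, ← ENNReal.ofReal_mul (by positivity)]
  congr 1
  rw [Real.sqrt_inv]
  field_simp

/-- The normalized Lebesgue measure on a period. -/
def periodMeasure : Measure ℝ :=
  ENNReal.ofReal (2 * Real.pi)⁻¹ • volume.restrict (Set.Ioc 0 (2 * Real.pi))

instance : IsProbabilityMeasure periodMeasure := by
  constructor
  have : 0 < 2 * Real.pi := by positivity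
  rw [periodMeasure, Measure.smul_apply, Measure.restrict_apply_univ, Real.volume_Ioc, smul_eq_mul,
    ← ENNReal.ofReal_mul (by positivity), sub_zero, inv_mul_cancel₀ this.ne', ENNReal.ofReal_one]

theorem integral_periodMeasure {G : Type*} [NormedAddCommGroup G] [NormedSpace ℝ G]
    (f : ℂ → G) :
    ∫ θ, f (circleMap 0 1 θ) ∂periodMeasure = Real.circleAverage f 0 1 := by
  have : 0 < 2 * Real.pi := by positivity
  rw [periodMeasure, integral_smul_measure, Real.circleAverage,
    intervalIntegral.integral_of_le this.le, ENNReal.toReal_ofReal (by positivity)]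

theorem integrable_periodMeasure {G : Type*} [NormedAddCommGroup G] {f : ℂ → G}
    (hf : CircleIntegrable f 0 1) :
    Integrable (fun θ => f (circleMap 0 1 θ)) periodMeasure := by
  have : 0 < 2 * Real.pi := by positivity
  rw [CircleIntegrable, intervalIntegrable_iff, Set.uIoc_of_le this.le] at hf
  exact hf.smul_measure (by simp)

theorem circleMap_zero_one_re (θ : ℝ) : (circleMap 0 1 θ).re = Real.cos θ := by
  simp [circleMap, Complex.exp_ofReal_mul_I_re]

instance : IsFiniteMeasure Polynomial.Chebyshev.measureT := by
  have := Polynomial.Chebyshev.integrable_measureT (f := fun _ => (1 : ℝ)) continuousOn_const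
  rw [integrable_const_iff] at this
  exact this.resolve_left one_ne_zero

theorem measurable_ofReal_cos : Measurable fun θ : ℝ => ((Real.cos θ : ℝ) : ℂ) := by fun_prop

/-- The arcsine measure is the projection of the uniform measure on the unit circle. -/
theorem arcsine_eq_map_cos :
    arcsine = periodMeasure.map fun θ : ℝ => ((Real.cos θ : ℝ) : ℂ) := by
  rw [arcsine_eq_map_measureT]
  have : IsFiniteMeasure (ENNReal.ofReal (1 / Real.pi) • Polynomial.Chebyshev.measureT) :=
    Measure.smul_finite _ (by simp)
  have : IsFiniteMeasure (Measure.map Complex.ofReal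
    (ENNReal.ofReal (1 / Real.pi) • Polynomial.Chebyshev.measureT)) :=
    Measure.isFiniteMeasure_map _ _
  have : IsFiniteMeasure (periodMeasure.map fun θ : ℝ => ((Real.cos θ : ℝ) : ℂ)) :=
    Measure.isFiniteMeasure_map _ _
  apply ext_of_forall_integral_eq_of_IsFiniteMeasure
  intro h
  have hc : Continuous fun θ : ℝ => h ((Real.cos θ : ℝ) : ℂ) := by fun_prop
  rw [integral_map (by fun_prop) h.continuous.aestronglyMeasurable,
    integral_map (by fun_prop) h.continuous.aestronglyMeasurable, integral_smul_measure,
    Polynomial.Chebyshev.integral_measureT_eq_integral_cos (f := fun x => h (x : ℂ)),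
    periodMeasure, integral_smul_measure, ← intervalIntegral.integral_of_le (by positivity),
    ENNReal.toReal_ofReal (by positivity), ENNReal.toReal_ofReal (by positivity),
    ← intervalIntegral.integral_add_adjacent_intervals (a := 0) (b := Real.pi) (c := 2 * Real.pi)
      (hc.intervalIntegrable _ _) (hc.intervalIntegrable _ _)]
  -- The reflection `θ ↦ 2π - θ` fixes the cosine and identifies the two half-periods.
  have h2 := intervalIntegral.integral_comp_sub_left
    (fun θ : ℝ => h ((Real.cos θ : ℝ) : ℂ)) (2 * Real.pi) (a := Real.pi) (b := 2 * Real.pi)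
  simp only [Real.cos_two_pi_sub] at h2
  rw [h2, sub_self, show 2 * Real.pi - Real.pi = Real.pi by ring, smul_eq_mul, smul_eq_mul]
  field_simp
  ring

instance : IsProbabilityMeasure arcsine := by
  rw [arcsine_eq_map_cos]
  exact Measure.isProbabilityMeasure_map measurable_ofReal_cos.aemeasurable

theorem arcsine_compl_E : arcsine Eᶜ = 0 := by
  rw [arcsine_eq_map_cos, Measure.map_apply measurable_ofReal_cos
    isCompact_E.isClosed.measurableSet.compl]
  have : (fun θ : ℝ => ((Real.cos θ : ℝ) : ℂ)) ⁻¹' Eᶜ = ∅ := by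
    ext θ
    simp only [Set.mem_preimage, Set.mem_compl_iff, Set.mem_empty_iff_false, iff_false, not_not,
      ofReal_mem_E]
    exact ⟨Real.neg_one_le_cos θ, Real.cos_le_one θ⟩
  rw [this, measure_empty]

theorem arcsine_singleton (z : ℂ) : arcsine {z} = 0 := by
  unfold arcsine
  rw [Measure.map_apply (by fun_prop) (measurableSet_singleton z)]
  apply withDensity_absolutelyContinuous
  refine Measure.absolutelyContinuous_of_le Measure.restrict_le_self ?_
  apply Set.Subsingleton.measure_zero
  intro a ha b hb
  exact Complex.ofReal_injective (ha.trans hb.symm)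

/-- The point of the upper unit semicircle above `x`. -/
def circleLift (x : ℝ) : ℂ := x + √(1 - x ^ 2) * I

theorem circleLift_re (x : ℝ) : (circleLift x).re = x := by simp [circleLift]

theorem circleLift_im (x : ℝ) : (circleLift x).im = √(1 - x ^ 2) := by simp [circleLift]

theorem normSq_lift {x : ℝ} (hx : -1 ≤ x ∧ x ≤ 1) : normSq (circleLift x) = 1 := by
  rw [normSq_apply, circleLift_re, circleLift_im, Real.mul_self_sqrt (by nlinarith)]
  ring

theorem norm_lift {x : ℝ} (hx : -1 ≤ x ∧ x ≤ 1) : ‖circleLift x‖ = 1 := by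
  have := normSq_lift hx
  rw [normSq_eq_norm_sq] at this
  exact (pow_eq_one_iff_of_nonneg (norm_nonneg _) two_ne_zero).1 this

theorem circleLift_mul_conj {x : ℝ} (hx : -1 ≤ x ∧ x ≤ 1) :
    circleLift x * (starRingEnd ℂ) (circleLift x) = 1 := by
  rw [mul_conj, normSq_lift hx, ofReal_one]

theorem circleLift_add_conj (x : ℝ) : circleLift x + (starRingEnd ℂ) (circleLift x) = 2 * x := by
  rw [add_conj, circleLift_re]; push_cast; ring

/-- For `s` on the circle, `(s - ℓ)(s - ℓ̄) = 2 s (Re s - x)` where `ℓ` is the lift of `x`. This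
turns the logarithmic kernel on the segment into two logarithmic kernels on the circle. -/
theorem norm_sub_lift_mul {x : ℝ} (hx : -1 ≤ x ∧ x ≤ 1) {s : ℂ} (hs : ‖s‖ = 1) :
    ‖s - circleLift x‖ * ‖s - (starRingEnd ℂ) (circleLift x)‖ = 2 * ‖(x : ℂ) - s.re‖ := by
  have h1 := circleLift_mul_conj hx
  have h2 := circleLift_add_conj x
  have h3 : s * (starRingEnd ℂ) s = 1 := by
    rw [mul_conj, normSq_eq_norm_sq, hs]; simp
  have h4 : s + (starRingEnd ℂ) s = 2 * s.re := by rw [add_conj]; push_cast; ring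
  rw [← norm_mul]
  have : (s - circleLift x) * (s - (starRingEnd ℂ) (circleLift x)) = s * (-2 * (x - s.re)) := by
    linear_combination h1 - s * h2 - h3 + s * h4
  rw [this, norm_mul, hs, norm_mul, norm_neg, Complex.norm_ofNat, one_mul]

theorem measurable_log_inv_norm (z : ℂ) : Measurable fun t : ℂ => Real.log (1 / ‖z - t‖) := by
  fun_prop

theorem circleIntegrable_log_norm_sub (a : ℂ) :
    CircleIntegrable (fun s => Real.log ‖s - a‖) 0 1 := by
  apply MeromorphicOn.circleIntegrable_log_norm
  intro s _
  exact AnalyticAt.meromorphicAt (by fun_prop)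

theorem log_inv_norm_ae_eq {x : ℝ} (hx : -1 ≤ x ∧ x ≤ 1) :
    (fun θ : ℝ => Real.log (1 / ‖(x : ℂ) - ((Real.cos θ : ℝ) : ℂ)‖)) =ᵐ[periodMeasure]
      fun θ => Real.log 2 - Real.log ‖circleMap 0 1 θ - circleLift x‖ -
        Real.log ‖circleMap 0 1 θ - (starRingEnd ℂ) (circleLift x)‖ := by
  have h0 := arcsine_singleton x
  rw [arcsine_eq_map_cos, Measure.map_apply measurable_ofReal_cos (measurableSet_singleton _)] at h0
  filter_upwards [measure_eq_zero_iff_ae_notMem.1 h0] with θ hθ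
  have hne : (x : ℂ) - ((Real.cos θ : ℝ) : ℂ) ≠ 0 := fun h => hθ (sub_eq_zero.1 h).symm
  have h := norm_sub_lift_mul hx (s := circleMap 0 1 θ) (by simp [norm_circleMap_zero])
  rw [circleMap_zero_one_re] at h
  have hp : 0 < ‖(x : ℂ) - ((Real.cos θ : ℝ) : ℂ)‖ := norm_pos_iff.2 hne
  have h1 : ‖circleMap 0 1 θ - circleLift x‖ ≠ 0 := by intro h'; rw [h'] at h; linarith
  have h2 : ‖circleMap 0 1 θ - (starRingEnd ℂ) (circleLift x)‖ ≠ 0 := by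
    intro h'; rw [h'] at h; linarith
  have h3 := congrArg Real.log h
  rw [Real.log_mul h1 h2, Real.log_mul two_ne_zero hp.ne'] at h3
  rw [one_div, Real.log_inv]
  linarith

/-- After lifting to the circle, the average of `log |s - a|` for `|a| = 1` is `log⁺ 1 = 0`; only
the constant `log 2` survives. -/
theorem isRobinMeasure_arcsine : IsRobinMeasure E arcsine (Real.log 2) where
  isProbabilityMeasure := inferInstance
  measure_compl := arcsine_compl_E
  noAtom x _ := arcsine_singleton x
  integrable := by
    rintro _ ⟨x, hx, rfl⟩
    rw [arcsine_eq_map_cos, integrable_map_measure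
      (measurable_log_inv_norm _).aestronglyMeasurable measurable_ofReal_cos.aemeasurable]
    refine Integrable.congr ?_ (log_inv_norm_ae_eq hx).symm
    exact ((integrable_const _).sub
      (integrable_periodMeasure (circleIntegrable_log_norm_sub _))).sub
      (integrable_periodMeasure (circleIntegrable_log_norm_sub _))
  potential_eq := by
    rintro _ ⟨x, hx, rfl⟩
    rw [logPotential, arcsine_eq_map_cos, integral_map measurable_ofReal_cos.aemeasurable
      (measurable_log_inv_norm _).aestronglyMeasurable]
    rw [integral_congr_ae (log_inv_norm_ae_eq hx), integral_sub, integral_sub,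
      integral_periodMeasure (fun s => Real.log ‖s - circleLift x‖),
      integral_periodMeasure (fun s => Real.log ‖s - (starRingEnd ℂ) (circleLift x)‖),
      circleAverage_log_norm_sub_const_eq_posLog, circleAverage_log_norm_sub_const_eq_posLog,
      norm_conj, norm_lift hx]
    · simp
    · exact integrable_const _
    · exact integrable_periodMeasure (circleIntegrable_log_norm_sub _)
    · exact (integrable_const _).sub
        (integrable_periodMeasure (circleIntegrable_log_norm_sub _))
    · exact integrable_periodMeasure (circleIntegrable_log_norm_sub _)

theorem tendsto_phi_div_cocompact :
    Tendsto (fun z => phi z / z) (cocompact ℂ) (𝓝 2) := by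
  have h1 : Tendsto (fun z : ℂ => 1 + (1 - (z⁻¹) ^ 2) ^ (1 / 2 : ℂ)) (cocompact ℂ)
      (𝓝 (1 + (1 - 0 ^ 2) ^ (1 / 2 : ℂ))) := by
    have hc : ContinuousAt (fun u : ℂ => 1 + (1 - u ^ 2) ^ (1 / 2 : ℂ)) 0 := by
      have : ContinuousAt (fun u : ℂ => (1 - u ^ 2) ^ (1 / 2 : ℂ)) 0 := by
        exact ContinuousAt.cpow (by fun_prop) (by fun_prop) (by simp)
      exact continuousAt_const.add this
    exact hc.tendsto.comp ((tendsto_inv₀_cobounded' (α := ℂ)).mono_left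
      (Metric.cobounded_eq_cocompact (α := ℂ)).ge |>.mono_right nhdsWithin_le_nhds)
  norm_num at h1
  refine h1.congr' ?_
  filter_upwards [isCompact_E.compl_mem_cocompact] with z hz
  have hz0 : z ≠ 0 := fun h => hz (h ▸ zero_mem_E)
  rw [phi_eq_of_notMem hz]
  field_simp

/-- The constant comes from `phi z / z → 2` at infinity. The boundary limit uses continuity of the
modulus of `phi` on the whole plane, together with its value 1 on `E`. -/
theorem isGreenFunction_green : IsGreenFunction E green (Real.log 2) where
  harmonic z hz := (analyticAt_phi hz).harmonicAt_log_norm (phi_ne_zero z)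
  infinity := by
    have h := (tendsto_phi_div_cocompact.norm).log (by simp)
    rw [Complex.norm_ofNat] at h
    refine h.congr' ?_
    filter_upwards [isCompact_E.compl_mem_cocompact] with z hz
    have hz0 : z ≠ 0 := fun h => hz (h ▸ zero_mem_E)
    rw [norm_div, Real.log_div (norm_ne_zero_iff.2 (phi_ne_zero z)) (norm_ne_zero_iff.2 hz0), green]
  boundary x hx := by
    have hxE : x ∈ E := isCompact_E.isClosed.frontier_subset hx
    have h : ContinuousAt green x :=
      continuous_norm_phi.continuousAt.log (norm_ne_zero_iff.2 (phi_ne_zero x))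
    have h0 : green x = 0 := by rw [green, norm_phi_of_mem_E hxE, Real.log_one]
    have := h.tendsto
    rw [h0] at this
    exact this.mono_left nhdsWithin_le_nhds

theorem expNegGreen_eq (ζ : OnePoint ℂ) : expNegGreen ζ = ‖invPhi ζ‖ := by
  induction ζ using OnePoint.rec with
  | infty => simp [expNegGreen, invPhi]
  | coe z =>
    change Real.exp (-green z) = ‖1 / phi z‖
    rw [green, Real.exp_neg, Real.exp_log (norm_pos_iff.2 (phi_ne_zero z)), norm_div, norm_one,
      one_div]

theorem coe_mem_D {z : ℂ} : (z : OnePoint ℂ) ∈ D ↔ z ∉ E := by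
  simp [D]

theorem norm_invPhi_lt_one {ζ : OnePoint ℂ} (h : ζ ∈ D) : ‖invPhi ζ‖ < 1 := by
  induction ζ using OnePoint.rec with
  | infty => simp [invPhi]
  | coe z =>
    change ‖1 / phi z‖ < 1
    rw [one_div, norm_inv]
    exact inv_lt_one_of_one_lt₀ (one_lt_norm_phi (coe_mem_D.1 h))

theorem continuous_norm_invPhi : Continuous fun ζ : OnePoint ℂ => ‖invPhi ζ‖ := by
  rw [continuous_iff_continuousAt]
  intro ζ
  induction ζ using OnePoint.rec with
  | infty =>
    rw [OnePoint.continuousAt_infty', coclosedCompact_eq_cocompact]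
    have h : Tendsto (fun z => ‖phi z‖) (cocompact ℂ) atTop :=
      tendsto_atTop_mono norm_le_norm_phi tendsto_norm_cocompact_atTop
    have := h.inv_tendsto_atTop
    simp only [invPhi, OnePoint.elim_infty, norm_zero]
    refine this.congr fun z => ?_
    simp
  | coe z =>
    rw [OnePoint.continuousAt_coe]
    have : (fun ζ : OnePoint ℂ => ‖invPhi ζ‖) ∘ OnePoint.some = fun z : ℂ => ‖phi z‖⁻¹ := by
      ext z; simp [invPhi]
    rw [this]
    exact continuous_norm_phi.continuousAt.inv₀ (norm_ne_zero_iff.2 (phi_ne_zero z))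

theorem exists_norm_invPhi_le {K : Set (OnePoint ℂ)} (hK : IsCompact K) (hKD : K ⊆ D) :
    ∃ r : ℝ, 0 ≤ r ∧ r < 1 ∧ ∀ ζ ∈ K, ‖invPhi ζ‖ ≤ r := by
  rcases K.eq_empty_or_nonempty with rfl | hne
  · exact ⟨0, le_rfl, one_pos, by simp⟩
  obtain ⟨ζ, hζ, hmax⟩ := hK.exists_isMaxOn hne continuous_norm_invPhi.continuousOn
  exact ⟨‖invPhi ζ‖, norm_nonneg _, norm_invPhi_lt_one (hKD hζ), fun η hη => hmax hη⟩

end PadeModel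
end

/-! ### The positive functional `sig` and the Markov representation. -/

noncomputable section
namespace PadeModel
open Complex Filter MeasureTheory Metric

/-- The functional `g ↦ ∫ g dσ` for the projection to `[-1, 1]` of the measure with density
`(Im s)² k(s)` with respect to the normalized arc length of the unit circle. -/
def sig (k : ℂ → ℝ) (g : ℝ → ℂ) : ℂ :=
  Real.circleAverage (fun s => g s.re * ((s.im ^ 2 * k s : ℝ) : ℂ)) 0 1

/-- `F` is holomorphic in the unit disc, and its jump `F(s) - F(1/s)` over the unit circle
is `2 i Im(s) k(s)` with a positive continuous factor `k`. -/
structure HasPositiveJump (F : ℂ → ℂ) (k : ℂ → ℝ) : Prop where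
  diffContOnCl : DiffContOnCl ℂ F (ball 0 1)
  continuousOn : ContinuousOn k (sphere 0 1)
  pos : ∀ s ∈ sphere (0 : ℂ) 1, 0 < k s
  jump : ∀ s ∈ sphere (0 : ℂ) 1, F s - F s⁻¹ = 2 * I * s.im * k s

variable {k : ℂ → ℝ}

theorem re_mem_Icc {s : ℂ} (hs : s ∈ sphere (0 : ℂ) 1) : s.re ∈ Set.Icc (-1 : ℝ) 1 := by
  have := abs_re_le_norm s
  rw [mem_sphere_zero_iff_norm.1 hs] at this
  exact abs_le.1 this

theorem continuousOn_sig (hk : ContinuousOn k (sphere 0 1)) {g : ℝ → ℂ}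
    (hg : ContinuousOn g (Set.Icc (-1) 1)) :
    ContinuousOn (fun s : ℂ => g s.re * ((s.im ^ 2 * k s : ℝ) : ℂ)) (sphere 0 1) := by
  have h1 : ContinuousOn (fun s : ℂ => g s.re) (sphere 0 1) :=
    hg.comp Complex.continuous_re.continuousOn fun s hs => re_mem_Icc hs
  have h2 : ContinuousOn (fun s : ℂ => s.im ^ 2 * k s) (sphere 0 1) :=
    (Complex.continuous_im.continuousOn.pow 2).mul hk
  exact h1.mul (Complex.continuous_ofReal.comp_continuousOn h2)

theorem circleIntegrable_sig (hk : ContinuousOn k (sphere 0 1)) {g : ℝ → ℂ}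
    (hg : ContinuousOn g (Set.Icc (-1) 1)) :
    CircleIntegrable (fun s : ℂ => g s.re * ((s.im ^ 2 * k s : ℝ) : ℂ)) 0 1 :=
  (continuousOn_sig hk hg).circleIntegrable zero_le_one

theorem circleAverage_congr {G : Type*} [NormedAddCommGroup G] [NormedSpace ℝ G] {f g : ℂ → G}
    (h : ∀ s ∈ sphere (0 : ℂ) 1, f s = g s) :
    Real.circleAverage f 0 1 = Real.circleAverage g 0 1 :=
  Real.circleAverage_congr_sphere (by rwa [abs_one])

theorem sig_congr {f g : ℝ → ℂ} (h : ∀ x ∈ Set.Icc (-1 : ℝ) 1, f x = g x) :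
    sig k f = sig k g :=
  circleAverage_congr fun s hs => by rw [h _ (re_mem_Icc hs)]

theorem sig_add (hk : ContinuousOn k (sphere 0 1)) {f g : ℝ → ℂ}
    (hf : ContinuousOn f (Set.Icc (-1) 1)) (hg : ContinuousOn g (Set.Icc (-1) 1)) :
    sig k (fun x => f x + g x) = sig k f + sig k g := by
  unfold sig
  rw [← Real.circleAverage_fun_add (circleIntegrable_sig hk hf) (circleIntegrable_sig hk hg)]
  simp only [add_mul]

theorem sig_const_mul (c : ℂ) (f : ℝ → ℂ) : sig k (fun x => c * f x) = c * sig k f := by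
  unfold sig
  rw [← smul_eq_mul, ← Real.circleAverage_fun_smul]
  simp only [smul_eq_mul, mul_assoc]

theorem sig_zero : sig k (fun _ => 0) = 0 := by
  simp [sig, Real.circleAverage]

theorem sig_sub (hk : ContinuousOn k (sphere 0 1)) {f g : ℝ → ℂ}
    (hf : ContinuousOn f (Set.Icc (-1) 1)) (hg : ContinuousOn g (Set.Icc (-1) 1)) :
    sig k (fun x => f x - g x) = sig k f - sig k g := by
  have := sig_add hk hf (g := fun x => (-1) * g x) (continuousOn_const.mul hg)
  rw [sig_const_mul] at this
  rw [sub_eq_add_neg, ← neg_one_mul, ← this]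
  simp only [neg_one_mul, sub_eq_add_neg]

theorem sig_sum (hk : ContinuousOn k (sphere 0 1)) {ι : Type*} (t : Finset ι) {f : ι → ℝ → ℂ}
    (hf : ∀ i ∈ t, ContinuousOn (f i) (Set.Icc (-1) 1)) :
    sig k (fun x => ∑ i ∈ t, f i x) = ∑ i ∈ t, sig k (f i) := by
  classical
  induction t using Finset.induction_on with
  | empty => simpa using sig_zero
  | insert a t ha ih =>
    simp only [Finset.sum_insert ha]
    rw [sig_add hk (hf a (by simp)), ih fun i hi => hf i (by simp [hi])]
    exact continuousOn_finsetSum _ fun i hi => hf i (by simp [hi])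

theorem norm_circleAverage_le {f : ℂ → ℂ} {g : ℂ → ℝ} (hg : ContinuousOn g (sphere 0 1))
    (h : ∀ s ∈ sphere (0 : ℂ) 1, ‖f s‖ ≤ g s) :
    ‖Real.circleAverage f 0 1‖ ≤ Real.circleAverage g 0 1 := by
  unfold Real.circleAverage
  rw [norm_smul, smul_eq_mul, Real.norm_of_nonneg (by positivity)]
  gcongr
  refine intervalIntegral.norm_integral_le_of_norm_le (by positivity) ?_
    (hg.circleIntegrable zero_le_one)
  filter_upwards with θ _
  exact h _ (circleMap_mem_sphere 0 zero_le_one θ)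

theorem circleAverage_le {f g : ℂ → ℝ} (hf : ContinuousOn f (sphere 0 1))
    (hg : ContinuousOn g (sphere 0 1)) (h : ∀ s ∈ sphere (0 : ℂ) 1, f s ≤ g s) :
    Real.circleAverage f 0 1 ≤ Real.circleAverage g 0 1 :=
  Real.circleAverage_mono (hf.circleIntegrable zero_le_one) (hg.circleIntegrable zero_le_one)
    (by rwa [abs_one])

theorem re_circleAverage {f : ℂ → ℂ} (hf : ContinuousOn f (sphere 0 1)) :
    (Real.circleAverage f 0 1).re = Real.circleAverage (fun s => (f s).re) 0 1 := by
  have := Complex.reCLM.circleAverage_comp_comm (hf.circleIntegrable zero_le_one)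
  exact this.symm

theorem sphere_add_inv {s : ℂ} (hs : s ∈ sphere (0 : ℂ) 1) : s + s⁻¹ = 2 * s.re := by
  rw [inv_eq_conj (mem_sphere_zero_iff_norm.1 hs), add_conj]
  push_cast; rfl

theorem sphere_sub_inv {s : ℂ} (hs : s ∈ sphere (0 : ℂ) 1) : s - s⁻¹ = 2 * I * s.im := by
  rw [inv_eq_conj (mem_sphere_zero_iff_norm.1 hs), sub_conj]
  push_cast; ring

theorem sphere_ne_zero {s : ℂ} (hs : s ∈ sphere (0 : ℂ) 1) : s ≠ 0 := by
  rintro rfl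
  simp at hs

theorem one_sub_two_mul_add_sq_eq {s w : ℂ} (hs : s ∈ sphere (0 : ℂ) 1) :
    1 - 2 * s.re * w + w ^ 2 = (1 - w * s) * (1 - w * s⁻¹) := by
  have h0 := mul_inv_cancel₀ (sphere_ne_zero hs)
  have h1 := sphere_add_inv hs
  linear_combination w * h1 - w ^ 2 * h0

theorem one_sub_mul_ne_zero {w s : ℂ} (hw : ‖w‖ < 1) (hs : ‖s‖ ≤ 1) : 1 - w * s ≠ 0 := by
  intro h
  have h1 : w * s = 1 := (sub_eq_zero.1 h).symm
  have := congrArg norm h1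
  rw [norm_mul, norm_one] at this
  nlinarith [norm_nonneg w, norm_nonneg s]

theorem one_sub_two_mul_add_sq_eq_lift {x : ℝ} (hx : -1 ≤ x ∧ x ≤ 1) (w : ℂ) :
    1 - 2 * (x : ℂ) * w + w ^ 2 =
      (1 - w * circleLift x) * (1 - w * (starRingEnd ℂ) (circleLift x)) := by
  linear_combination w * circleLift_add_conj x - w ^ 2 * circleLift_mul_conj hx

theorem one_sub_two_mul_add_sq_ne_zero {x : ℝ} (hx : -1 ≤ x ∧ x ≤ 1) {w : ℂ} (hw : ‖w‖ < 1) :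
    1 - 2 * (x : ℂ) * w + w ^ 2 ≠ 0 := by
  rw [one_sub_two_mul_add_sq_eq_lift hx]
  exact mul_ne_zero (one_sub_mul_ne_zero hw (norm_lift hx).le)
    (one_sub_mul_ne_zero hw (by rw [norm_conj, norm_lift hx]))

/-- A holomorphic function with a jump `2 i Im(s) k(s)` is the Markov function of the measure with
density `(Im s)² k(s)`, in the variable `w` with `ζ = (w + 1/w)/2`. -/
theorem HasPositiveJump.sub_eq_sig {F : ℂ → ℂ} (h : HasPositiveJump F k) {w : ℂ} (hw : ‖w‖ < 1) :
    F w - F 0 = sig k fun x => 2 * w / (1 - 2 * (x : ℂ) * w + w ^ 2) := by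
  have hFc : ContinuousOn F (sphere 0 1) := by
    refine h.diffContOnCl.2.mono ?_
    rw [closure_ball _ one_ne_zero]
    exact sphere_subset_closedBall
  have hne1 : ∀ s ∈ sphere (0 : ℂ) 1, 1 - w * s ≠ 0 := fun s hs =>
    one_sub_mul_ne_zero hw (mem_sphere_zero_iff_norm.1 hs).le
  have hne2 : ∀ s ∈ sphere (0 : ℂ) 1, 1 - w * s⁻¹ ≠ 0 := fun s hs =>
    one_sub_mul_ne_zero hw (by rw [norm_inv, mem_sphere_zero_iff_norm.1 hs, inv_one])
  have hinv : ContinuousOn (fun s : ℂ => s⁻¹) (sphere 0 1) :=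
    continuousOn_inv₀.mono fun s hs => sphere_ne_zero hs
  -- This kernel is odd under `s ↦ s⁻¹`. Pairing it with `F(s) - F(s⁻¹)` therefore symmetrises `κ
  -- F`, and the inversion invariance of the circle average removes the symmetrisation. The first
  -- term then reproduces `F w` by Cauchy's formula, the second `F 0` by the mean value property.
  set κ : ℂ → ℂ := fun s => 1 / (1 - w * s⁻¹) - 1 / (1 - w * s) with hκ
  have hκc : ContinuousOn κ (sphere 0 1) :=
    (continuousOn_const.div (continuousOn_const.sub (continuousOn_const.mul hinv)) hne2).sub
      (continuousOn_const.div (by fun_prop) hne1)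
  have hinvmem : ∀ s ∈ sphere (0 : ℂ) 1, s⁻¹ ∈ sphere (0 : ℂ) 1 := fun s hs => by
    rw [mem_sphere_zero_iff_norm, norm_inv, mem_sphere_zero_iff_norm.1 hs, inv_one]
  have hκF : ContinuousOn (fun s => κ s * F s) (sphere 0 1) := hκc.mul hFc
  have hκF' : ContinuousOn (fun s => κ s⁻¹ * F s⁻¹) (sphere 0 1) :=
    hκF.comp hinv hinvmem
  have e1 : sig k (fun x => 2 * w / (1 - 2 * (x : ℂ) * w + w ^ 2)) =
      Real.circleAverage (fun s => (1 / 2 : ℂ) • (κ s * F s + κ s⁻¹ * F s⁻¹)) 0 1 := by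
    apply circleAverage_congr
    intro s hs
    have hj := h.jump s hs
    have hκs : κ s = -(2 * I * w * s.im) / (1 - 2 * s.re * w + w ^ 2) := by
      have := sphere_sub_inv hs
      change 1 / (1 - w * s⁻¹) - 1 / (1 - w * s) = _
      rw [one_sub_two_mul_add_sq_eq hs, div_sub_div _ _ (hne2 s hs) (hne1 s hs),
        mul_comm (1 - w * s)]
      congr 1
      linear_combination (-w) * this
    have hκs' : κ s⁻¹ = -κ s := by simp [hκ]
    rw [hκs', smul_eq_mul,
      show (1 / 2 : ℂ) * (κ s * F s + -κ s * F s⁻¹) = (1 / 2) * κ s * (F s - F s⁻¹) by ring, hj,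
      hκs]
    push_cast
    linear_combination (2 * w / (1 - 2 * s.re * w + w ^ 2)) * (s.im : ℂ) ^ 2 * k s * I_sq
  rw [e1, Real.circleAverage_fun_smul, Real.circleAverage_fun_add
    (hκF.circleIntegrable zero_le_one) (hκF'.circleIntegrable zero_le_one),
    Real.circleAverage_zero_one_congr_inv (f := fun s => κ s * F s)]
  have hA : Real.circleAverage (fun s => ((s - 0) / (s - w)) • F s) 0 1 = F w :=
    DiffContOnCl.circleAverage_smul_div (by rw [abs_one]; exact h.diffContOnCl)
      (by simpa using hw)
  have hB : Real.circleAverage (fun s => (1 / (1 - w * s)) * F s) 0 1 =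
      (1 / (1 - w * 0)) * F 0 := by
    refine DiffContOnCl.circleAverage (f := fun s => (1 / (1 - w * s)) * F s) ?_
    rw [abs_one]
    have hc : DiffContOnCl ℂ (fun s : ℂ => 1 - w * s) (ball 0 1) :=
      Differentiable.diffContOnCl (by fun_prop)
    have := hc.inv fun s hs => by
      rw [closure_ball _ one_ne_zero] at hs
      exact one_sub_mul_ne_zero hw (by simpa using hs)
    simp only [one_div]
    exact this.smul h.diffContOnCl
  have hS : Real.circleAverage (fun s => κ s * F s) 0 1 = F w - F 0 := by
    rw [mul_zero, sub_zero, div_one, one_mul] at hB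
    rw [← hA, ← hB, ← Real.circleAverage_fun_sub]
    · apply circleAverage_congr
      intro s hs
      have h0 := sphere_ne_zero hs
      have h2 := hne2 s hs
      have h3 : 1 - w * s⁻¹ = (s - w) / s := by field_simp
      rw [h3] at h2
      change (1 / (1 - w * s⁻¹) - 1 / (1 - w * s)) * F s = _
      rw [h3, smul_eq_mul, one_div_div]
      ring
    · refine ContinuousOn.circleIntegrable zero_le_one ?_
      refine ContinuousOn.smul (f := fun s : ℂ => (s - 0) / (s - w))
        (ContinuousOn.div (by fun_prop) (by fun_prop) fun s hs hsw => ?_) hFc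
      rw [sub_eq_zero] at hsw
      rw [← hsw, mem_sphere_zero_iff_norm.1 hs] at hw
      exact lt_irrefl _ hw
    · exact ((continuousOn_const.div (by fun_prop) hne1).mul hFc).circleIntegrable zero_le_one
  rw [hS, smul_eq_mul]
  ring

end PadeModel
end

/-! ### Orthogonality of the reflected Padé denominators. -/

noncomputable section
namespace PadeModel
open Complex Filter MeasureTheory Metric

variable {k : ℂ → ℝ}

theorem eval_reflect {n : ℕ} {Q : ℂ[X]} (hQ : Q.natDegree ≤ n) {z : ℂ} (hz : z ≠ 0) :
    (Q.reflect n).eval z = z ^ n * Q.eval z⁻¹ := by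
  let _ : Invertible z⁻¹ := invertibleOfNonzero (inv_ne_zero hz)
  have := Polynomial.eval₂_reflect_mul_pow (RingHom.id ℂ) z⁻¹ n Q hQ
  rw [invOf_eq_inv, inv_inv] at this
  change (Q.reflect n).eval z * z⁻¹ ^ n = Q.eval z⁻¹ at this
  rw [← this, inv_pow]
  field_simp

theorem sub_ofReal_ne_zero {z : ℂ} (hz : z ∉ E) {x : ℝ} (hx : x ∈ Set.Icc (-1 : ℝ) 1) :
    z - x ≠ 0 := fun h => hz (sub_eq_zero.1 h ▸ ofReal_mem_E.2 hx)

theorem continuousOn_div_sub {z : ℂ} (hz : z ∉ E) {g : ℝ → ℂ}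
    (hg : ContinuousOn g (Set.Icc (-1) 1)) :
    ContinuousOn (fun x : ℝ => g x / (z - x)) (Set.Icc (-1) 1) :=
  hg.div (by fun_prop) fun _ hx => sub_ofReal_ne_zero hz hx

theorem norm_inv_phi_lt_one {z : ℂ} (hz : z ∉ E) : ‖(phi z)⁻¹‖ < 1 := by
  rw [norm_inv]
  exact inv_lt_one_of_one_lt₀ (one_lt_norm_phi hz)

theorem two_mul_inv_phi {z : ℂ} : 2 * z * (phi z)⁻¹ = 1 + (phi z)⁻¹ ^ 2 := by
  have h := phi_add_inv z
  have h0 := mul_inv_cancel₀ (phi_ne_zero z)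
  linear_combination (-(phi z)⁻¹) * h + h0

/-- Identifies the kernel of the Markov representation in `w` with the Cauchy kernel in `z`. -/
theorem kernel_eq {z : ℂ} (hz : z ∉ E) {x : ℝ} (hx : x ∈ Set.Icc (-1 : ℝ) 1) :
    2 * (phi z)⁻¹ / (1 - 2 * (x : ℂ) * (phi z)⁻¹ + (phi z)⁻¹ ^ 2) = 1 / (z - x) := by
  rw [div_eq_div_iff (one_sub_two_mul_add_sq_ne_zero hx (norm_inv_phi_lt_one hz))
    (sub_ofReal_ne_zero hz hx)]
  linear_combination (two_mul_inv_phi (z := z))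

/-- The divided difference is a polynomial in both variables, so integrating out `x` leaves a
polynomial in `z`: the polynomial of the second kind. -/
theorem exists_sig_divided_difference (hk : ContinuousOn k (sphere 0 1)) (g : ℂ[X]) :
    ∃ d : ℂ[X], ∀ z ∉ E, d.eval z = sig k fun x => (g.eval z - g.eval (x : ℂ)) / (z - x) := by
  induction g using Polynomial.induction_on' with
  | add f g hf hg =>
    obtain ⟨d, hd⟩ := hf
    obtain ⟨e, he⟩ := hg
    refine ⟨d + e, fun z hz => ?_⟩
    rw [Polynomial.eval_add, hd z hz, he z hz, ← sig_add hk]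
    · refine sig_congr fun x _ => ?_
      rw [Polynomial.eval_add, Polynomial.eval_add]
      ring
    · exact continuousOn_div_sub hz (by fun_prop)
    · exact continuousOn_div_sub hz (by fun_prop)
  | monomial m a =>
    refine ⟨∑ i ∈ Finset.range m, Polynomial.C (sig k fun x => a * (x : ℂ) ^ (m - 1 - i)) *
      Polynomial.X ^ i, fun z hz => ?_⟩
    rw [Polynomial.eval_finsetSum]
    simp only [Polynomial.eval_mul, Polynomial.eval_C, Polynomial.eval_pow, Polynomial.eval_X,
      Polynomial.eval_monomial]
    have h1 : ∀ x ∈ Set.Icc (-1 : ℝ) 1, (a * z ^ m - a * (x : ℂ) ^ m) / (z - x) =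
        ∑ i ∈ Finset.range m, z ^ i * (a * (x : ℂ) ^ (m - 1 - i)) := by
      intro x hx
      rw [div_eq_iff (sub_ofReal_ne_zero hz hx), ← mul_sub,
        ← (Commute.all z (x : ℂ)).geom_sum₂_mul, ← mul_assoc, Finset.mul_sum]
      congr 1
      exact Finset.sum_congr rfl fun i _ => by ring
    rw [sig_congr h1, sig_sum hk]
    · refine Finset.sum_congr rfl fun i _ => ?_
      rw [sig_const_mul, sig_const_mul, sig_const_mul]
      ring
    · intro i _
      fun_prop

theorem eq_zero_of_tendsto_eval {S : ℂ[X]}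
    (h : Tendsto (fun z => S.eval z) (Bornology.cobounded ℂ) (𝓝 0)) : S = 0 := by
  by_cases hd : 0 < S.degree
  · exact absurd h.norm (not_tendsto_nhds_of_tendsto_atTop
      (S.tendsto_norm_atTop hd tendsto_norm_cobounded_atTop) _)
  · rw [Polynomial.eq_C_of_degree_le_zero (not_lt.1 hd)] at h ⊢
    simp only [Polynomial.eval_C, tendsto_const_nhds_iff] at h
    rw [h, Polynomial.C_0]

theorem tendsto_sig_div_sub (hk : ContinuousOn k (sphere 0 1)) {g : ℝ → ℂ}
    (hg : ContinuousOn g (Set.Icc (-1) 1)) :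
    Tendsto (fun z : ℂ => sig k fun x => g x / (z - x)) (Bornology.cobounded ℂ) (𝓝 0) := by
  have hc := (continuousOn_sig hk hg).norm
  set M := Real.circleAverage (fun s : ℂ => ‖g s.re * ((s.im ^ 2 * k s : ℝ) : ℂ)‖) 0 1
  have hn : Tendsto (fun z : ℂ => (‖z‖ - 1)⁻¹ * M) (Bornology.cobounded ℂ) (𝓝 0) := by
    have : Tendsto (fun z : ℂ => ‖z‖ - 1) (Bornology.cobounded ℂ) atTop :=
      tendsto_atTop_add_const_right _ _ tendsto_norm_cobounded_atTop
    simpa using this.inv_tendsto_atTop.mul_const M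
  refine squeeze_zero_norm' ?_ hn
  filter_upwards [tendsto_norm_cobounded_atTop.eventually (eventually_gt_atTop (1 : ℝ))] with z hz
  rw [← smul_eq_mul, ← Real.circleAverage_fun_smul]
  simp only [smul_eq_mul]
  refine norm_circleAverage_le (continuousOn_const.mul hc) fun s hs => ?_
  rw [div_mul_eq_mul_div, norm_div, div_eq_inv_mul]
  gcongr
  · have h1 := norm_sub_norm_le z (s.re : ℂ)
    have h2 : ‖(s.re : ℂ)‖ ≤ 1 := by
      rw [norm_real, Real.norm_eq_abs]
      exact abs_le.2 (re_mem_Icc hs)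
    linarith

theorem recip_inv {z : ℂ} (hz : z ≠ 0) : recip z⁻¹ = (z : OnePoint ℂ) := by
  simp [recip, hz]

/-- Reflection and the extra factor `zⁿ` multiply the defect at `1/z` by `z^{2n}`, which leaves
`O(1/z)`. This is the only form in which the order of contact enters the orthogonality argument. -/
theorem IsPadePair.tendsto {f : ℂ → ℂ} {n : ℕ} {P Q : ℂ[X]} (h : IsPadePair f n P Q) :
    Tendsto (fun z : ℂ => z ^ n * ((Q.reflect n).eval z * f z⁻¹ - (P.reflect n).eval z))
      (Bornology.cobounded ℂ) (𝓝 0) := by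
  obtain ⟨-, hP, hQ, hO⟩ := h
  obtain ⟨C, hC⟩ := hO.bound
  have hn : Tendsto (fun z : ℂ => C * ‖z‖⁻¹) (Bornology.cobounded ℂ) (𝓝 0) := by
    simpa using (tendsto_norm_cobounded_atTop (E := ℂ)).inv_tendsto_atTop.const_mul C
  refine squeeze_zero_norm' ?_ hn
  have hinv : Tendsto (fun z : ℂ => z⁻¹) (Bornology.cobounded ℂ) (𝓝 0) := tendsto_inv₀_cobounded
  filter_upwards [hinv.eventually hC,
    tendsto_norm_cobounded_atTop.eventually (eventually_gt_atTop (0 : ℝ))] with z hz hz0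
  have hz1 : z ≠ 0 := norm_pos_iff.1 hz0
  rw [eval_reflect hQ hz1, eval_reflect hP hz1]
  rw [show z ^ n * (z ^ n * Q.eval z⁻¹ * f z⁻¹ - z ^ n * P.eval z⁻¹) =
    z ^ (2 * n) * (Q.eval z⁻¹ * f z⁻¹ - P.eval z⁻¹) by ring, norm_mul]
  calc ‖z ^ (2 * n)‖ * ‖Q.eval z⁻¹ * f z⁻¹ - P.eval z⁻¹‖
      ≤ ‖z ^ (2 * n)‖ * (C * ‖z⁻¹ ^ (2 * n + 1)‖) := by gcongr
    _ = C * ‖z‖⁻¹ := by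
      rw [norm_pow, norm_pow, norm_inv, inv_pow]
      field_simp
      ring

/-- Orthogonality of the reflected Padé denominators, and the formula for the remainder. -/
theorem IsPadePair.orthogonality {F : ℂ → ℂ} (h : HasPositiveJump F k) {n : ℕ} {P Q : ℂ[X]}
    (hPQ : IsPadePair (fun z => F (invPhi (recip z))) n P Q) :
    (∀ m < n, sig k (fun x => (Q.reflect n).eval (x : ℂ) * (x : ℂ) ^ m) = 0) ∧
    ∀ z ∉ E, (Q.reflect n).eval z * F (phi z)⁻¹ - (P.reflect n).eval z =
      sig k fun x => (Q.reflect n).eval (x : ℂ) / (z - x) := by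
  have hk := h.continuousOn
  have hlim := hPQ.tendsto
  set q := Q.reflect n
  set p := P.reflect n
  obtain ⟨d, hd⟩ := exists_sig_divided_difference hk q
  -- The polynomial part of `q F - p`; what remains is the Cauchy transform of `q`.
  set r := Polynomial.C (F 0) * q - p + d with hr
  -- The polynomial part of `zⁿ` times that Cauchy transform; its coefficients are exactly the
  -- moments that have to vanish.
  set T := ∑ m ∈ Finset.range n,
    Polynomial.C (sig k fun x => q.eval (x : ℂ) * (x : ℂ) ^ m) * Polynomial.X ^ (n - 1 - m) with hT
  have hrem : ∀ z ∉ E, q.eval z * F (phi z)⁻¹ - p.eval z =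
      r.eval z + sig k fun x => q.eval (x : ℂ) / (z - x) := by
    intro z hz
    have h1 := h.sub_eq_sig (norm_inv_phi_lt_one hz)
    rw [sig_congr fun x hx => kernel_eq hz hx] at h1
    have h2 : q.eval z * sig k (fun x => 1 / (z - x)) =
        d.eval z + sig k fun x => q.eval (x : ℂ) / (z - x) := by
      rw [hd z hz, ← sig_const_mul, ← sig_add hk]
      · exact sig_congr fun x _ => by ring
      · exact continuousOn_div_sub hz (by fun_prop)
      · exact continuousOn_div_sub hz (by fun_prop)
    rw [hr]
    simp only [Polynomial.eval_add, Polynomial.eval_sub, Polynomial.eval_mul, Polynomial.eval_C]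
    linear_combination q.eval z * h1 + h2
  have hTe : ∀ z ∉ E, z ^ n * sig k (fun x => q.eval (x : ℂ) / (z - x)) =
      T.eval z + sig k fun x => (x : ℂ) ^ n * q.eval (x : ℂ) / (z - x) := by
    intro z hz
    have e : T.eval z = sig k fun x => ∑ m ∈ Finset.range n,
        z ^ (n - 1 - m) * (q.eval (x : ℂ) * (x : ℂ) ^ m) := by
      rw [hT, Polynomial.eval_finsetSum, sig_sum hk (Finset.range n)
        (f := fun m x => z ^ (n - 1 - m) * (q.eval (x : ℂ) * (x : ℂ) ^ m)) fun i _ => by fun_prop]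
      refine Finset.sum_congr rfl fun i _ => ?_
      rw [sig_const_mul, Polynomial.eval_mul, Polynomial.eval_C, Polynomial.eval_pow,
        Polynomial.eval_X, mul_comm]
    rw [e, ← sig_const_mul, ← sig_add hk]
    · refine sig_congr fun x hx => ?_
      have hne := sub_ofReal_ne_zero hz hx
      have hg := (Commute.all z (x : ℂ)).geom_sum₂_mul n
      rw [← Finset.sum_range_reflect, Finset.sum_mul] at hg
      rw [mul_div_assoc', eq_comm, ← eq_sub_iff_add_eq, ← sub_div, eq_div_iff hne,
        Finset.sum_mul]
      rw [show z ^ n * q.eval (x : ℂ) - (x : ℂ) ^ n * q.eval (x : ℂ) =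
        q.eval (x : ℂ) * (z ^ n - (x : ℂ) ^ n) by ring, ← hg, Finset.mul_sum]
      refine Finset.sum_congr rfl fun m hm => ?_
      rw [Finset.mem_range] at hm
      rw [show n - 1 - (n - 1 - m) = m by omega]
      ring
    · fun_prop
    · exact continuousOn_div_sub hz (by fun_prop)
  -- A polynomial tending to 0 at infinity is zero. The two summands occupy disjoint ranges of
  -- degrees, at least `n` and below `n`, so the moments and `r` all vanish.
  have hS : Polynomial.X ^ n * r + T = 0 := by
    apply eq_zero_of_tendsto_eval
    have hl := hlim.sub (tendsto_sig_div_sub hk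
      (g := fun x : ℝ => (x : ℂ) ^ n * q.eval (x : ℂ)) (by fun_prop))
    rw [sub_zero] at hl
    refine hl.congr' ?_
    filter_upwards [Bornology.isBounded_def.1 isCompact_E.isBounded] with z hz
    have hz0 : z ≠ 0 := fun h => hz (h ▸ zero_mem_E)
    have hF : F (invPhi (recip z⁻¹)) = F (phi z)⁻¹ := by
      rw [recip_inv hz0]
      simp [invPhi]
    rw [hF, hrem z hz, mul_add, hTe z hz]
    simp only [Polynomial.eval_add, Polynomial.eval_mul, Polynomial.eval_pow, Polynomial.eval_X]
    ring
  have hcoeff : ∀ m < n, sig k (fun x => q.eval (x : ℂ) * (x : ℂ) ^ m) = 0 := by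
    intro m hm
    have h1 := congrArg (fun g : ℂ[X] => g.coeff (n - 1 - m)) hS
    simp only [Polynomial.coeff_add, Polynomial.coeff_X_pow_mul', Polynomial.coeff_zero] at h1
    rw [if_neg (by omega), zero_add, hT, Polynomial.finsetSum_coeff] at h1
    rw [Finset.sum_eq_single m] at h1
    · simpa using h1
    · intro b hb hbm
      rw [Finset.mem_range] at hb
      rw [Polynomial.coeff_C_mul_X_pow, if_neg (by omega)]
    · intro h'
      exact absurd (Finset.mem_range.2 hm) h'
  refine ⟨hcoeff, fun z hz => ?_⟩
  have hT0 : T = 0 := by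
    rw [hT]
    exact Finset.sum_eq_zero fun m hm => by
      rw [hcoeff m (Finset.mem_range.1 hm), Polynomial.C_0, zero_mul]
  rw [hT0, add_zero] at hS
  have hr0 : r = 0 := (mul_eq_zero.1 hS).resolve_left (pow_ne_zero _ Polynomial.X_ne_zero)
  rw [hrem z hz, hr0, Polynomial.eval_zero, zero_add]

end PadeModel
end

/-! ### Extremal properties of orthogonal polynomials and bounds for `joukProd`. -/

noncomputable section
namespace PadeModel
open Complex Filter MeasureTheory Metric

variable {k : ℂ → ℝ}

/-- The functional `sig` on real-valued functions. -/
def rsig (k : ℂ → ℝ) (f : ℝ → ℝ) : ℝ :=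
  Real.circleAverage (fun s => f s.re * (s.im ^ 2 * k s)) 0 1

/-- `q` is a nonzero polynomial of degree at most `n`, orthogonal to all powers below `n`. -/
structure IsOrthogonal (k : ℂ → ℝ) (n : ℕ) (q : ℂ[X]) : Prop where
  ne_zero : q ≠ 0
  natDegree_le : q.natDegree ≤ n
  sig_mul_pow : ∀ m < n, sig k (fun x => q.eval (x : ℂ) * (x : ℂ) ^ m) = 0

/-- `∏ (1 - 2 η w + w²)` over the points `η` of a multiset. -/
def joukProd (R : Multiset ℂ) (w : ℂ) : ℂ := (R.map fun η => 1 - 2 * η * w + w ^ 2).prod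

theorem joukProd_zero (R : Multiset ℂ) : joukProd R 0 = 1 := by
  simp [joukProd]

theorem joukProd_cons (η : ℂ) (R : Multiset ℂ) (w : ℂ) :
    joukProd (η ::ₘ R) w = (1 - 2 * η * w + w ^ 2) * joukProd R w := by
  simp [joukProd]

theorem differentiable_joukProd (R : Multiset ℂ) : Differentiable ℂ (joukProd R) := by
  induction R using Multiset.induction_on with
  | empty =>
    have : joukProd 0 = fun _ => 1 := by ext w; simp [joukProd]
    rw [this]
    fun_prop
  | cons η R ih =>
    have : joukProd (η ::ₘ R) = fun w => (1 - 2 * η * w + w ^ 2) * joukProd R w :=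
      funext fun w => joukProd_cons η R w
    rw [this]
    fun_prop

/-- Each factor is `2w (z - η)`. The powers of `2w` absorb the growth at infinity, so the product
remains regular at `w = 0`. -/
theorem joukProd_eq_prod (R : Multiset ℂ) {z w : ℂ} (h : 2 * z * w = 1 + w ^ 2) :
    joukProd R w = (2 * w) ^ R.card * (R.map fun η => z - η).prod := by
  induction R using Multiset.induction_on with
  | empty => simp [joukProd]
  | cons η R ih =>
    rw [joukProd_cons, ih, Multiset.map_cons, Multiset.prod_cons, Multiset.card_cons, pow_succ]
    linear_combination -((2 * w) ^ R.card * (R.map fun η => z - η).prod) * h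

theorem leadingCoeff_mul_joukProd (q : ℂ[X]) {z w : ℂ} (h : 2 * z * w = 1 + w ^ 2) :
    q.leadingCoeff * joukProd q.roots w = (2 * w) ^ q.natDegree * q.eval z := by
  have hs := IsAlgClosed.splits q
  rw [joukProd_eq_prod _ h, ← hs.natDegree_eq_card_roots, hs.eval_eq_prod_roots]
  ring

theorem continuousOn_rsig (hk : ContinuousOn k (sphere 0 1)) {f : ℝ → ℝ}
    (hf : ContinuousOn f (Set.Icc (-1) 1)) :
    ContinuousOn (fun s : ℂ => f s.re * (s.im ^ 2 * k s)) (sphere 0 1) :=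
  (hf.comp Complex.continuous_re.continuousOn fun _ hs => re_mem_Icc hs).mul
    ((Complex.continuous_im.continuousOn.pow 2).mul hk)

theorem sig_ofReal (hk : ContinuousOn k (sphere 0 1)) {f : ℝ → ℝ}
    (hf : ContinuousOn f (Set.Icc (-1) 1)) : sig k (fun x => (f x : ℂ)) = (rsig k f : ℂ) := by
  have := Complex.ofRealCLM.circleAverage_comp_comm
    ((continuousOn_rsig hk hf).circleIntegrable zero_le_one)
  unfold sig rsig
  refine Eq.trans ?_ this
  apply circleAverage_congr
  intro s _
  simp

theorem rsig_mono (hk : ContinuousOn k (sphere 0 1)) (hpos : ∀ s ∈ sphere (0 : ℂ) 1, 0 < k s)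
    {f g : ℝ → ℝ} (hf : ContinuousOn f (Set.Icc (-1) 1)) (hg : ContinuousOn g (Set.Icc (-1) 1))
    (h : ∀ x ∈ Set.Icc (-1 : ℝ) 1, f x ≤ g x) : rsig k f ≤ rsig k g :=
  circleAverage_le (continuousOn_rsig hk hf) (continuousOn_rsig hk hg) fun s hs =>
    mul_le_mul_of_nonneg_right (h _ (re_mem_Icc hs))
      (mul_nonneg (sq_nonneg _) (hpos s hs).le)

theorem norm_sig_le (hk : ContinuousOn k (sphere 0 1)) (hpos : ∀ s ∈ sphere (0 : ℂ) 1, 0 < k s)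
    {f : ℝ → ℂ} {g : ℝ → ℝ} (hg : ContinuousOn g (Set.Icc (-1) 1))
    (h : ∀ x ∈ Set.Icc (-1 : ℝ) 1, ‖f x‖ ≤ g x) : ‖sig k f‖ ≤ rsig k g := by
  refine norm_circleAverage_le (continuousOn_rsig hk hg) fun s hs => ?_
  have h0 : 0 ≤ s.im ^ 2 * k s := mul_nonneg (sq_nonneg _) (hpos s hs).le
  rw [norm_mul, norm_real, Real.norm_of_nonneg h0]
  exact mul_le_mul_of_nonneg_right (h _ (re_mem_Icc hs)) h0

theorem rsig_const_mul (c : ℝ) (f : ℝ → ℝ) : rsig k (fun x => c * f x) = c * rsig k f := by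
  unfold rsig
  rw [← smul_eq_mul, ← Real.circleAverage_fun_smul]
  simp only [smul_eq_mul, mul_assoc]

theorem rsig_add (hk : ContinuousOn k (sphere 0 1)) {f g : ℝ → ℝ}
    (hf : ContinuousOn f (Set.Icc (-1) 1)) (hg : ContinuousOn g (Set.Icc (-1) 1)) :
    rsig k (fun x => f x + g x) = rsig k f + rsig k g := by
  unfold rsig
  rw [← Real.circleAverage_fun_add ((continuousOn_rsig hk hf).circleIntegrable zero_le_one)
    ((continuousOn_rsig hk hg).circleIntegrable zero_le_one)]
  simp only [add_mul]

theorem eval_map_conj (g : ℂ[X]) (x : ℝ) :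
    (g.map (starRingEnd ℂ)).eval (x : ℂ) = (starRingEnd ℂ) (g.eval (x : ℂ)) := by
  rw [Polynomial.eval_map, ← conj_ofReal, Polynomial.eval₂_at_apply, conj_ofReal]

theorem IsOrthogonal.sig_mul (hk : ContinuousOn k (sphere 0 1)) {n : ℕ} {q : ℂ[X]}
    (hq : IsOrthogonal k n q) {g : ℂ[X]} (hg : g.degree < n) :
    sig k (fun x => q.eval (x : ℂ) * g.eval (x : ℂ)) = 0 := by
  by_cases hg0 : g = 0
  · simpa [hg0] using sig_zero
  have hd := (Polynomial.natDegree_lt_iff_degree_lt hg0).2 hg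
  have : ∀ x ∈ Set.Icc (-1 : ℝ) 1, q.eval (x : ℂ) * g.eval (x : ℂ) =
      ∑ i ∈ Finset.range n, g.coeff i * (q.eval (x : ℂ) * (x : ℂ) ^ i) := by
    intro x _
    rw [Polynomial.eval_eq_sum_range' hd, Finset.mul_sum]
    exact Finset.sum_congr rfl fun i _ => by ring
  rw [sig_congr this, sig_sum hk (Finset.range n)
    (f := fun i x => g.coeff i * (q.eval (x : ℂ) * (x : ℂ) ^ i)) fun i _ => by fun_prop]
  refine Finset.sum_eq_zero fun i hi => ?_
  rw [sig_const_mul, hq.sig_mul_pow i (Finset.mem_range.1 hi), mul_zero]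

theorem IsOrthogonal.sig_mul_conj (hk : ContinuousOn k (sphere 0 1)) {n : ℕ} {q : ℂ[X]}
    (hq : IsOrthogonal k n q) {g : ℂ[X]} (hg : g.degree < n) :
    sig k (fun x => q.eval (x : ℂ) * (starRingEnd ℂ) (g.eval (x : ℂ))) = 0 := by
  rw [← hq.sig_mul hk (g := g.map (starRingEnd ℂ)) ((Polynomial.degree_map_le).trans_lt hg)]
  simp only [eval_map_conj]

/-- This is why `1 - w²` accompanies `joukProd` below: on the circle its squared modulus supplies
the weight `(Im s)²` of `sig`. -/
theorem sphere_norm_one_sub_sq {s : ℂ} (hs : s ∈ sphere (0 : ℂ) 1) :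
    ‖1 - s ^ 2‖ ^ 2 = 4 * s.im ^ 2 := by
  have h1 := sphere_sub_inv hs
  have h0 := mul_inv_cancel₀ (sphere_ne_zero hs)
  have : 1 - s ^ 2 = -(s * (2 * I * s.im)) := by
    rw [← h1]; linear_combination -h0
  rw [this, norm_neg, norm_mul, mem_sphere_zero_iff_norm.1 hs, norm_mul, norm_mul, norm_I,
    norm_real, Complex.norm_ofNat, one_mul, mul_one, mul_pow, Real.norm_eq_abs, sq_abs]
  norm_num

theorem sphere_two_mul_re {s : ℂ} (hs : s ∈ sphere (0 : ℂ) 1) :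
    2 * (s.re : ℂ) * s = 1 + s ^ 2 := by
  rw [← sphere_add_inv hs]
  have h0 := mul_inv_cancel₀ (sphere_ne_zero hs)
  linear_combination h0

/-- On the unit circle, `joukProd` has the size of the polynomial on `[-1, 1]`. -/
theorem sphere_norm_joukProd (q : ℂ[X]) {s : ℂ} (hs : s ∈ sphere (0 : ℂ) 1) :
    ‖q.leadingCoeff‖ ^ 2 * ‖(joukProd q.roots s * (1 - s ^ 2)) ^ 2‖ =
      4 ^ (q.natDegree + 1) * ‖q.eval (s.re : ℂ)‖ ^ 2 * s.im ^ 2 := by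
  have h := leadingCoeff_mul_joukProd q (sphere_two_mul_re hs)
  rw [norm_pow, norm_mul, mul_pow, sphere_norm_one_sub_sq hs, ← mul_assoc, ← mul_pow, ← norm_mul, h,
    norm_mul, norm_pow, norm_mul, mem_sphere_zero_iff_norm.1 hs, Complex.norm_ofNat, mul_one,
    mul_pow, ← pow_mul, mul_comm q.natDegree 2, pow_mul, pow_succ]
  norm_num
  ring

theorem differentiable_joukProd_mul (R : Multiset ℂ) :
    Differentiable ℂ fun w => (joukProd R w * (1 - w ^ 2)) ^ 2 := by
  have := differentiable_joukProd R
  fun_prop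

/-- Mean value property, with value 1 at the centre. It is the source of every lower bound on the
norms of polynomials. -/
theorem one_le_circleAverage_joukProd (R : Multiset ℂ) :
    1 ≤ Real.circleAverage (fun s => ‖(joukProd R s * (1 - s ^ 2)) ^ 2‖) 0 1 := by
  have hd := differentiable_joukProd_mul R
  have h1 := DiffContOnCl.circleAverage (R := 1) (c := 0) hd.diffContOnCl
  have h2 := norm_circleAverage_le (f := fun s => (joukProd R s * (1 - s ^ 2)) ^ 2)
    hd.continuous.norm.continuousOn fun s _ => le_rfl
  rw [h1] at h2
  simpa [joukProd_zero] using h2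

/-- Cauchy's formula for the holomorphic square costs one power of `1 - ‖w‖`; removing `(1 - w²)²`
costs two more. -/
theorem norm_sq_joukProd_le (R : Multiset ℂ) {w : ℂ} (hw : ‖w‖ < 1) :
    ‖joukProd R w‖ ^ 2 ≤
      Real.circleAverage (fun s => ‖(joukProd R s * (1 - s ^ 2)) ^ 2‖) 0 1 / (1 - ‖w‖) ^ 3 := by
  have hd := differentiable_joukProd_mul R
  have h1 := DiffContOnCl.circleAverage_smul_div (R := 1) (c := 0) (w := w) hd.diffContOnCl
    (by simpa using hw)
  have hp : 0 < 1 - ‖w‖ := by linarith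
  set A := Real.circleAverage (fun s => ‖(joukProd R s * (1 - s ^ 2)) ^ 2‖) 0 1
  have h2 : ‖(joukProd R w * (1 - w ^ 2)) ^ 2‖ ≤ (1 - ‖w‖)⁻¹ * A := by
    rw [← h1, ← smul_eq_mul, ← Real.circleAverage_fun_smul]
    refine norm_circleAverage_le
      (by simp only [smul_eq_mul]; exact continuousOn_const.mul hd.continuous.norm.continuousOn)
      fun s hs => ?_
    rw [norm_smul, smul_eq_mul]
    gcongr
    rw [norm_div, sub_zero, mem_sphere_zero_iff_norm.1 hs, one_div]
    gcongr
    have := norm_sub_norm_le s w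
    rwa [mem_sphere_zero_iff_norm.1 hs] at this
  have h3 : 1 - ‖w‖ ≤ ‖1 - w ^ 2‖ := by
    have := norm_sub_norm_le (1 : ℂ) (w ^ 2)
    rw [norm_one, norm_pow] at this
    nlinarith [norm_nonneg w]
  rw [norm_pow, norm_mul, mul_pow] at h2
  rw [le_div_iff₀ (by positivity)]
  calc ‖joukProd R w‖ ^ 2 * (1 - ‖w‖) ^ 3
      = (‖joukProd R w‖ ^ 2 * (1 - ‖w‖) ^ 2) * (1 - ‖w‖) := by ring
    _ ≤ (‖joukProd R w‖ ^ 2 * ‖1 - w ^ 2‖ ^ 2) * (1 - ‖w‖) := by gcongr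
    _ ≤ ((1 - ‖w‖)⁻¹ * A) * (1 - ‖w‖) := by gcongr
    _ = A := by field_simp

theorem exists_pos_le_on_sphere (hk : ContinuousOn k (sphere 0 1))
    (hpos : ∀ s ∈ sphere (0 : ℂ) 1, 0 < k s) : ∃ c > 0, ∀ s ∈ sphere (0 : ℂ) 1, c ≤ k s := by
  obtain ⟨s, hs, hmin⟩ := (isCompact_sphere (0 : ℂ) 1).exists_isMinOn
    ⟨1, by simp⟩ hk
  exact ⟨k s, hpos s hs, fun t ht => hmin ht⟩

/-- The mean of `‖joukProd‖²` is controlled by the `L²(σ)` norm of the polynomial. -/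
theorem circleAverage_joukProd_le (hk : ContinuousOn k (sphere 0 1)) {c : ℝ}
    (hck : ∀ s ∈ sphere (0 : ℂ) 1, c ≤ k s) (q : ℂ[X]) :
    c * (‖q.leadingCoeff‖ ^ 2 *
      Real.circleAverage (fun s => ‖(joukProd q.roots s * (1 - s ^ 2)) ^ 2‖) 0 1) ≤
      4 ^ (q.natDegree + 1) * rsig k fun x => ‖q.eval (x : ℂ)‖ ^ 2 := by
  unfold rsig
  rw [← smul_eq_mul (a := ‖q.leadingCoeff‖ ^ 2), ← Real.circleAverage_fun_smul,
    ← smul_eq_mul (a := c), ← Real.circleAverage_fun_smul,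
    ← smul_eq_mul (a := (4 : ℝ) ^ (q.natDegree + 1)), ← Real.circleAverage_fun_smul]
  have hd := (differentiable_joukProd_mul q.roots).continuous
  refine circleAverage_le ?_ ?_ fun s hs => ?_
  · exact Continuous.continuousOn (by fun_prop)
  · exact continuousOn_const.mul (continuousOn_rsig hk (f := fun x => ‖q.eval (x : ℂ)‖ ^ 2)
      (by fun_prop))
  · simp only [smul_eq_mul]
    rw [sphere_norm_joukProd q hs]
    have := hck s hs
    calc _ = 4 ^ (q.natDegree + 1) * (‖q.eval (s.re : ℂ)‖ ^ 2 * (s.im ^ 2 * c)) := by ring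
      _ ≤ _ := by gcongr

/-- Quantitative: the mean value bound keeps the integral above a positive multiple of the squared
leading coefficient, so the zero set of `q` need not be examined. -/
theorem rsig_pos (hk : ContinuousOn k (sphere 0 1)) (hpos : ∀ s ∈ sphere (0 : ℂ) 1, 0 < k s)
    {q : ℂ[X]} (hq : q ≠ 0) : 0 < rsig k fun x => ‖q.eval (x : ℂ)‖ ^ 2 := by
  obtain ⟨c, hc, hck⟩ := exists_pos_le_on_sphere hk hpos
  have h := circleAverage_joukProd_le hk hck q
  have h1 := one_le_circleAverage_joukProd q.roots
  have hl : 0 < ‖q.leadingCoeff‖ := norm_pos_iff.2 (Polynomial.leadingCoeff_ne_zero.2 hq)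
  have : 0 < 4 ^ (q.natDegree + 1) * rsig k fun x => ‖q.eval (x : ℂ)‖ ^ 2 :=
    lt_of_lt_of_le (by positivity) h
  exact pos_of_mul_pos_right this (by positivity)

theorem sig_mul_conj_self (hk : ContinuousOn k (sphere 0 1)) (q : ℂ[X]) :
    sig k (fun x => q.eval (x : ℂ) * (starRingEnd ℂ) (q.eval (x : ℂ))) =
      ((rsig k fun x => ‖q.eval (x : ℂ)‖ ^ 2 : ℝ) : ℂ) := by
  rw [← sig_ofReal hk (f := fun x => ‖q.eval (x : ℂ)‖ ^ 2) (by fun_prop)]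
  refine sig_congr fun x _ => ?_
  rw [mul_conj, normSq_eq_norm_sq]

/-- A polynomial of lower degree would be orthogonal to itself. -/
theorem IsOrthogonal.natDegree_eq (hk : ContinuousOn k (sphere 0 1))
    (hpos : ∀ s ∈ sphere (0 : ℂ) 1, 0 < k s) {n : ℕ} {q : ℂ[X]} (hq : IsOrthogonal k n q) :
    q.natDegree = n := by
  refine le_antisymm hq.natDegree_le (not_lt.1 fun hlt => ?_)
  have h := hq.sig_mul_conj hk ((Polynomial.natDegree_lt_iff_degree_lt hq.ne_zero).1 hlt)
  rw [sig_mul_conj_self hk, ofReal_eq_zero] at h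
  exact (rsig_pos hk hpos hq.ne_zero).ne' h

/-- The zeros of the orthogonal polynomials lie on `[-1, 1]`. -/
theorem IsOrthogonal.mem_E_of_mem_roots (hk : ContinuousOn k (sphere 0 1))
    (hpos : ∀ s ∈ sphere (0 : ℂ) 1, 0 < k s) {n : ℕ} {q : ℂ[X]} (hq : IsOrthogonal k n q)
    {η : ℂ} (hη : η ∈ q.roots) : η ∈ E := by
  obtain ⟨g, hg⟩ := Polynomial.dvd_iff_isRoot.2 ((Polynomial.mem_roots hq.ne_zero).1 hη)
  have hg0 : g ≠ 0 := by
    rintro rfl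
    exact hq.ne_zero (by simpa using hg)
  have hdeg : g.natDegree < n := by
    have := hq.natDegree_le
    rw [hg, Polynomial.natDegree_mul (Polynomial.X_sub_C_ne_zero η) hg0,
      Polynomial.natDegree_X_sub_C] at this
    omega
  -- Orthogonality of `q = (X - η) g` to `g` exhibits `η` as the mean of `x` for the positive weight
  -- `|g|² dσ`, hence as a point of `[-1, 1]`.
  have h := hq.sig_mul_conj hk ((Polynomial.natDegree_lt_iff_degree_lt hg0).1 hdeg)
  have hpw : ∀ x ∈ Set.Icc (-1 : ℝ) 1, q.eval (x : ℂ) * (starRingEnd ℂ) (g.eval (x : ℂ)) =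
      ((x * ‖g.eval (x : ℂ)‖ ^ 2 : ℝ) : ℂ) - η * ((‖g.eval (x : ℂ)‖ ^ 2 : ℝ) : ℂ) := by
    intro x _
    have hn : g.eval (x : ℂ) * (starRingEnd ℂ) (g.eval (x : ℂ)) =
        ((‖g.eval (x : ℂ)‖ ^ 2 : ℝ) : ℂ) := by rw [mul_conj, normSq_eq_norm_sq]
    have he : q.eval (x : ℂ) = (x - η) * g.eval (x : ℂ) := by
      rw [hg]
      simp
    rw [he, mul_assoc, hn]
    push_cast
    ring
  rw [sig_congr hpw, sig_sub hk (Continuous.continuousOn (by fun_prop))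
    (Continuous.continuousOn (by fun_prop)), sig_const_mul,
    sig_ofReal hk (f := fun x => x * ‖g.eval (x : ℂ)‖ ^ 2) (by fun_prop),
    sig_ofReal hk (f := fun x => ‖g.eval (x : ℂ)‖ ^ 2) (by fun_prop)] at h
  have hp := rsig_pos hk hpos hg0
  have h1 := rsig_mono hk hpos (f := fun x => x * ‖g.eval (x : ℂ)‖ ^ 2)
    (g := fun x => ‖g.eval (x : ℂ)‖ ^ 2) (by fun_prop) (by fun_prop)
    fun x hx => mul_le_of_le_one_left (by positivity) hx.2
  have h2 := rsig_mono hk hpos (f := fun x => (-1) * ‖g.eval (x : ℂ)‖ ^ 2)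
    (g := fun x => x * ‖g.eval (x : ℂ)‖ ^ 2) (by fun_prop) (by fun_prop)
    fun x hx => by gcongr; exact hx.1
  rw [rsig_const_mul] at h2
  set a := rsig k fun x => x * ‖g.eval (x : ℂ)‖ ^ 2
  set b := rsig k fun x => ‖g.eval (x : ℂ)‖ ^ 2
  have hηe : η = ((a / b : ℝ) : ℂ) := by
    have hb : (b : ℂ) ≠ 0 := ofReal_ne_zero.2 hp.ne'
    push_cast
    rw [eq_div_iff hb]
    exact (sub_eq_zero.1 h).symm
  rw [hηe, ofReal_mem_E]
  constructor
  · rw [le_div_iff₀ hp]; exact h2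
  · rw [div_le_one hp]; exact h1

/-- Minimality of the orthogonal polynomials. -/
theorem IsOrthogonal.rsig_le (hk : ContinuousOn k (sphere 0 1))
    (hpos : ∀ s ∈ sphere (0 : ℂ) 1, 0 < k s) {n : ℕ} {q g : ℂ[X]} (hq : IsOrthogonal k n q)
    (hgd : g.degree = n) (hgl : g.leadingCoeff = q.leadingCoeff) :
    rsig k (fun x => ‖q.eval (x : ℂ)‖ ^ 2) ≤ rsig k fun x => ‖g.eval (x : ℂ)‖ ^ 2 := by
  have hqd : q.degree = n := by
    rw [Polynomial.degree_eq_natDegree hq.ne_zero, hq.natDegree_eq hk hpos]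
  have hlt : (q - g).degree < n :=
    hqd ▸ Polynomial.degree_sub_lt_left (hqd.trans hgd.symm) hq.ne_zero hgl.symm
  have h := hq.sig_mul_conj hk hlt
  have hc : ∀ x ∈ Set.Icc (-1 : ℝ) 1, q.eval (x : ℂ) * (starRingEnd ℂ) ((q - g).eval (x : ℂ)) =
      q.eval (x : ℂ) * (starRingEnd ℂ) (q.eval (x : ℂ)) -
        q.eval (x : ℂ) * (starRingEnd ℂ) (g.eval (x : ℂ)) := by
    intro x _
    rw [Polynomial.eval_sub, map_sub, mul_sub]
  rw [sig_congr hc, sig_sub hk (Continuous.continuousOn (by fun_prop))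
    (Continuous.continuousOn (by fun_prop)), sig_mul_conj_self hk, sub_eq_zero] at h
  -- Since `∫ |q|² = ∫ q ḡ`, the inequality `ab ≤ (a² + b²)/2` is enough.
  have hle := norm_sig_le hk hpos
    (f := fun x => q.eval (x : ℂ) * (starRingEnd ℂ) (g.eval (x : ℂ)))
    (g := fun x => (1 / 2) * ‖q.eval (x : ℂ)‖ ^ 2 + (1 / 2) * ‖g.eval (x : ℂ)‖ ^ 2)
    (by fun_prop) fun x _ => by
      rw [norm_mul, norm_conj]
      nlinarith [sq_nonneg (‖q.eval (x : ℂ)‖ - ‖g.eval (x : ℂ)‖)]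
  rw [← h, rsig_add hk (Continuous.continuousOn (by fun_prop))
    (Continuous.continuousOn (by fun_prop)), rsig_const_mul, rsig_const_mul, norm_real,
    Real.norm_of_nonneg (rsig_pos hk hpos hq.ne_zero).le] at hle
  linarith

theorem IsOrthogonal.rsig_upper (hk : ContinuousOn k (sphere 0 1))
    (hpos : ∀ s ∈ sphere (0 : ℂ) 1, 0 < k s) {n : ℕ} {q : ℂ[X]} (hq : IsOrthogonal k n q) :
    4 ^ n * rsig k (fun x => ‖q.eval (x : ℂ)‖ ^ 2) ≤
      4 * ‖q.leadingCoeff‖ ^ 2 * rsig k fun _ => 1 := by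
  have hl : q.leadingCoeff ≠ 0 := Polynomial.leadingCoeff_ne_zero.2 hq.ne_zero
  -- The competitor is the Chebyshev polynomial, rescaled to the leading coefficient of `q`. For `n
  -- = 0` the truncated exponent gives `2⁰ = 1`, the correct leading coefficient, and `2ⁿ ≤ 2 ·
  -- 2^{n-1}` still holds.
  set c : ℂ := q.leadingCoeff / 2 ^ (n - 1) with hcdef
  have hc : c ≠ 0 := div_ne_zero hl (pow_ne_zero _ two_ne_zero)
  have hle := hq.rsig_le hk hpos (g := Polynomial.C c * Polynomial.Chebyshev.T ℂ n)
    (by rw [Polynomial.degree_C_mul hc, Polynomial.Chebyshev.degree_T]; simp)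
    (by
      rw [Polynomial.leadingCoeff_mul, Polynomial.leadingCoeff_C,
        Polynomial.Chebyshev.leadingCoeff_T, Int.natAbs_natCast, hcdef]
      exact div_mul_cancel₀ _ (pow_ne_zero _ two_ne_zero))
  have hb : ∀ x ∈ Set.Icc (-1 : ℝ) 1,
      4 ^ n * ‖(Polynomial.C c * Polynomial.Chebyshev.T ℂ n).eval (x : ℂ)‖ ^ 2 ≤
        4 * ‖q.leadingCoeff‖ ^ 2 * 1 := by
    intro x hx
    have hT : (Polynomial.Chebyshev.T ℂ n).eval (x : ℂ) =
        (((Polynomial.Chebyshev.T ℝ n).eval x : ℝ) : ℂ) :=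
      (Polynomial.Chebyshev.algebraMap_eval_T (R' := ℂ) x n).symm
    have hT1 := Polynomial.Chebyshev.abs_eval_T_real_le_one n (abs_le.2 hx)
    rw [Polynomial.eval_mul, Polynomial.eval_C, hT, norm_mul, norm_real, Real.norm_eq_abs, hcdef,
      norm_div, norm_pow, Complex.norm_ofNat]
    have h2 : (2 : ℝ) ^ n ≤ 2 * 2 ^ (n - 1) := by
      rw [← pow_succ']
      exact pow_le_pow_right₀ one_le_two (by omega)
    set l := ‖q.leadingCoeff‖
    set t := |(Polynomial.Chebyshev.T ℝ n).eval x|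
    have h3 : (2 : ℝ) ^ n * (l / 2 ^ (n - 1) * t) ≤ 2 * l := by
      calc (2 : ℝ) ^ n * (l / 2 ^ (n - 1) * t)
          ≤ (2 * 2 ^ (n - 1)) * (l / 2 ^ (n - 1) * 1) := by gcongr
        _ = 2 * l := by field_simp
    calc 4 ^ n * (l / 2 ^ (n - 1) * t) ^ 2 = ((2 : ℝ) ^ n * (l / 2 ^ (n - 1) * t)) ^ 2 := by
          rw [mul_pow (2 ^ n : ℝ), ← pow_mul, mul_comm n 2, pow_mul]; norm_num
      _ ≤ (2 * l) ^ 2 := by gcongr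
      _ = _ := by ring
  calc 4 ^ n * rsig k (fun x => ‖q.eval (x : ℂ)‖ ^ 2)
      ≤ 4 ^ n * rsig k (fun x =>
        ‖(Polynomial.C c * Polynomial.Chebyshev.T ℂ n).eval (x : ℂ)‖ ^ 2) := by gcongr
    _ ≤ 4 * ‖q.leadingCoeff‖ ^ 2 * rsig k fun _ => 1 := by
      rw [← rsig_const_mul, ← rsig_const_mul]
      exact rsig_mono hk hpos (by fun_prop) (by fun_prop) hb

theorem rsig_lower (hk : ContinuousOn k (sphere 0 1)) {c : ℝ}
    (hck : ∀ s ∈ sphere (0 : ℂ) 1, c ≤ k s) (hc : 0 < c) {n : ℕ} {q : ℂ[X]}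
    (hn : q.natDegree = n) :
    c / 4 * ‖q.leadingCoeff‖ ^ 2 ≤ 4 ^ n * rsig k (fun x => ‖q.eval (x : ℂ)‖ ^ 2) := by
  have h := circleAverage_joukProd_le hk hck q
  have h1 := one_le_circleAverage_joukProd q.roots
  rw [hn, pow_succ 4 n] at h
  have : c * (‖q.leadingCoeff‖ ^ 2 * 1) ≤ c * (‖q.leadingCoeff‖ ^ 2 *
      Real.circleAverage (fun s => ‖(joukProd q.roots s * (1 - s ^ 2)) ^ 2‖) 0 1) := by gcongr
  linarith

/-- Locally uniform bound for `joukProd` of the zeros of the orthogonal polynomials. -/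
theorem exists_norm_joukProd_le (hk : ContinuousOn k (sphere 0 1))
    (hpos : ∀ s ∈ sphere (0 : ℂ) 1, 0 < k s) :
    ∃ C > 0, ∀ (n : ℕ) (q : ℂ[X]), IsOrthogonal k n q → ∀ w : ℂ, ‖w‖ < 1 →
      ‖joukProd q.roots w‖ ^ 2 ≤ C / (1 - ‖w‖) ^ 3 := by
  obtain ⟨c, hc, hck⟩ := exists_pos_le_on_sphere hk hpos
  have hM : 0 < rsig k fun _ => 1 := by
    simpa using rsig_pos hk hpos (one_ne_zero (α := ℂ[X]))
  -- One factor 4 comes from `4^{n+1}` in the circle estimate, the other from the Chebyshev bound.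
  refine ⟨16 * (rsig k fun _ => 1) / c, by positivity, fun n q hq w hw => ?_⟩
  have hp : 0 < 1 - ‖w‖ := by linarith
  refine (norm_sq_joukProd_le q.roots hw).trans ?_
  gcongr
  have h := circleAverage_joukProd_le hk hck q
  rw [hq.natDegree_eq hk hpos, pow_succ 4 n] at h
  have h2 := hq.rsig_upper hk hpos
  have hl : 0 < ‖q.leadingCoeff‖ :=
    norm_pos_iff.2 (Polynomial.leadingCoeff_ne_zero.2 hq.ne_zero)
  rw [le_div_iff₀ hc]
  refine le_of_mul_le_mul_left ?_ (show 0 < ‖q.leadingCoeff‖ ^ 2 by positivity)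
  linarith

end PadeModel
end

/-! ### The logarithm of `joukProd` and bounded Chebyshev sums. -/

noncomputable section
namespace PadeModel
open Complex Filter MeasureTheory Metric

/-- The logarithm of `1 - 2 x w + w²` that vanishes at `w = 0`. -/
def logJouk (x : ℝ) (w : ℂ) : ℂ :=
  Complex.log (1 - w * circleLift x) + Complex.log (1 - w * (starRingEnd ℂ) (circleLift x))

/-- The logarithm of `joukProd R` that vanishes at `w = 0`, for points of `[-1, 1]`. -/
def logProd (R : Multiset ℂ) (w : ℂ) : ℂ := (R.map fun η => logJouk η.re w).sum

theorem mem_E_re {η : ℂ} (h : η ∈ E) : (-1 ≤ η.re ∧ η.re ≤ 1) ∧ (η.re : ℂ) = η := by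
  obtain ⟨x, hx, rfl⟩ := h
  exact ⟨hx, rfl⟩

theorem one_sub_mul_mem_slitPlane {w s : ℂ} (hw : ‖w‖ < 1) (hs : ‖s‖ ≤ 1) :
    1 - w * s ∈ slitPlane := by
  have h : ‖w * s‖ < 1 := by
    rw [norm_mul]
    nlinarith [norm_nonneg w, norm_nonneg s]
  refine Complex.mem_slitPlane_iff.2 (Or.inl ?_)
  have := re_le_norm (w * s)
  rw [sub_re, one_re]
  linarith

theorem norm_conj_lift_le {x : ℝ} (hx : -1 ≤ x ∧ x ≤ 1) : ‖(starRingEnd ℂ) (circleLift x)‖ ≤ 1 := by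
  rw [norm_conj, norm_lift hx]

theorem logProd_cons (η : ℂ) (R : Multiset ℂ) (w : ℂ) :
    logProd (η ::ₘ R) w = logJouk η.re w + logProd R w := by
  simp [logProd]

theorem logProd_zero (R : Multiset ℂ) : logProd R 0 = 0 := by
  simp [logProd, logJouk]

theorem differentiableOn_logJouk {x : ℝ} (hx : -1 ≤ x ∧ x ≤ 1) :
    DifferentiableOn ℂ (logJouk x) (ball 0 1) := by
  unfold logJouk
  refine DifferentiableOn.add ?_ ?_
  · refine DifferentiableOn.clog (by fun_prop) fun w hw => ?_
    exact one_sub_mul_mem_slitPlane (by simpa using hw) (norm_lift hx).le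
  · refine DifferentiableOn.clog (by fun_prop) fun w hw => ?_
    exact one_sub_mul_mem_slitPlane (by simpa using hw) (norm_conj_lift_le hx)

theorem differentiableOn_logProd {R : Multiset ℂ} (hR : ∀ η ∈ R, η ∈ E) :
    DifferentiableOn ℂ (logProd R) (ball 0 1) := by
  induction R using Multiset.induction_on with
  | empty =>
    have : logProd 0 = fun _ => 0 := by ext w; simp [logProd]
    rw [this]
    fun_prop
  | cons η R ih =>
    have : logProd (η ::ₘ R) = fun w => logJouk η.re w + logProd R w :=
      funext fun w => logProd_cons η R w
    rw [this]
    exact (differentiableOn_logJouk (mem_E_re (hR η (by simp))).1).add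
      (ih fun ξ hξ => hR ξ (by simp [hξ]))

theorem exp_logProd {R : Multiset ℂ} (hR : ∀ η ∈ R, η ∈ E) {w : ℂ} (hw : ‖w‖ < 1) :
    Complex.exp (logProd R w) = joukProd R w := by
  induction R using Multiset.induction_on with
  | empty => simp [logProd, joukProd]
  | cons η R ih =>
    have hη := mem_E_re (hR η (by simp))
    rw [logProd_cons, joukProd_cons, Complex.exp_add, ih fun ξ hξ => hR ξ (by simp [hξ]), logJouk,
      Complex.exp_add, Complex.exp_log (one_sub_mul_ne_zero hw (norm_lift hη.1).le),
      Complex.exp_log (one_sub_mul_ne_zero hw (norm_conj_lift_le hη.1)),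
      ← one_sub_two_mul_add_sq_eq_lift hη.1, hη.2]

theorem re_logProd {R : Multiset ℂ} (hR : ∀ η ∈ R, η ∈ E) {w : ℂ} (hw : ‖w‖ < 1) :
    Real.exp (logProd R w).re = ‖joukProd R w‖ := by
  rw [← exp_logProd hR hw, Complex.norm_exp]

theorem pow_add_pow_eq_T {a b x : ℂ} (hab : a * b = 1) (hx : a + b = 2 * x) (m : ℕ) :
    a ^ m + b ^ m = 2 * (Polynomial.Chebyshev.T ℂ m).eval x := by
  induction m using Nat.twoStepInduction with
  | zero => norm_num
  | one => simpa using hx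
  | more m ih1 ih2 =>
    have hT := Polynomial.Chebyshev.T_add_two ℂ m
    push_cast at ih2 ⊢
    rw [hT]
    simp only [Polynomial.eval_sub, Polynomial.eval_mul, Polynomial.eval_ofNat, Polynomial.eval_X]
    linear_combination (a ^ (m + 1) + b ^ (m + 1)) * hx - (a ^ m + b ^ m) * hab + 2 * x * ih2 - ih1

/-- Adding the logarithmic series at the two conjugate lifts produces `ℓ^m + ℓ̄^m = 2 T_m(x)`. The
term `m = 0` is zero through division by zero, in agreement with the normalisation at the origin. -/
theorem hasSum_logJouk {x : ℝ} (hx : -1 ≤ x ∧ x ≤ 1) {w : ℂ} (hw : ‖w‖ < 1) :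
    HasSum (fun m : ℕ => -(2 * (Polynomial.Chebyshev.T ℂ m).eval (x : ℂ)) / m * w ^ m)
      (logJouk x w) := by
  have h1 : ∀ s : ℂ, ‖s‖ ≤ 1 → HasSum (fun m : ℕ => (w * s) ^ m / m) (-Complex.log (1 - w * s)) :=
    fun s hs => Complex.hasSum_taylorSeries_neg_log (by
      rw [norm_mul]; nlinarith [norm_nonneg w, norm_nonneg s])
  have h2 := ((h1 _ (norm_lift hx).le).add (h1 _ (norm_conj_lift_le hx))).neg
  have h3 : logJouk x w =
      -(-Complex.log (1 - w * circleLift x) + -Complex.log (1 - w * (starRingEnd ℂ) (circleLift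
          x))) := by
    rw [logJouk]; ring
  rw [h3]
  have h4 : (fun m : ℕ => -(2 * (Polynomial.Chebyshev.T ℂ m).eval (x : ℂ)) / m * w ^ m) =
      fun m : ℕ => -((w * circleLift x) ^ m / m + (w * (starRingEnd ℂ) (circleLift x)) ^ m / m)
          := by
    ext m
    rw [← pow_add_pow_eq_T (circleLift_mul_conj hx) (circleLift_add_conj x) m, mul_pow, mul_pow]
    ring
  rw [h4]
  exact h2

theorem hasSum_logProd {R : Multiset ℂ} (hR : ∀ η ∈ R, η ∈ E) {w : ℂ} (hw : ‖w‖ < 1) :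
    HasSum (fun m : ℕ =>
      -(2 * (R.map fun η => (Polynomial.Chebyshev.T ℂ m).eval η).sum) / m * w ^ m)
      (logProd R w) := by
  induction R using Multiset.induction_on with
  | empty => simp [logProd, hasSum_zero]
  | cons η R ih =>
    have hη := mem_E_re (hR η (by simp))
    have h := (hasSum_logJouk hη.1 hw).add (ih fun ξ hξ => hR ξ (by simp [hξ]))
    rw [logProd_cons]
    convert h using 1
    ext m
    rw [hη.2, Multiset.map_cons, Multiset.sum_cons]
    ring

theorem norm_eval_T_le {η : ℂ} (h : η ∈ E) (m : ℕ) :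
    ‖(Polynomial.Chebyshev.T ℂ m).eval η‖ ≤ 1 := by
  obtain ⟨hx, he⟩ := mem_E_re h
  have hT : (Polynomial.Chebyshev.T ℂ m).eval (η.re : ℂ) =
      (((Polynomial.Chebyshev.T ℝ m).eval η.re : ℝ) : ℂ) :=
    (Polynomial.Chebyshev.algebraMap_eval_T (R' := ℂ) η.re m).symm
  rw [← he, hT, norm_real, Real.norm_eq_abs]
  exact Polynomial.Chebyshev.abs_eval_T_real_le_one m (abs_le.2 hx)

/-- Cauchy's estimate for the coefficients of a power series with bounded coefficients. -/
theorem norm_coeff_le_of_hasSum {f : ℂ → ℂ} {a : ℕ → ℂ} {A : ℝ} (ha : ∀ m, ‖a m‖ ≤ A)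
    (hf : ∀ w, ‖w‖ < 1 → HasSum (fun m => a m * w ^ m) (f w)) {r B : ℝ} (hr0 : 0 < r)
    (hr1 : r < 1) (hd : DifferentiableOn ℂ f (ball 0 1))
    (hB : ∀ w ∈ sphere (0 : ℂ) r, ‖f w‖ ≤ B) (m : ℕ) : ‖a m‖ ≤ B * r⁻¹ ^ m := by
  have hps : HasFPowerSeriesOnBall f (FormalMultilinearSeries.ofScalars ℂ a) 0 1 := by
    refine ⟨?_, one_pos, fun {y} hy => ?_⟩
    · have := (FormalMultilinearSeries.ofScalars ℂ a).le_radius_of_bound A (r := 1) fun n => by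
        rw [FormalMultilinearSeries.ofScalars_norm]
        simpa using ha n
      simpa using this
    · have hy' : ‖y‖ < 1 := by
        rwa [mem_eball_zero_iff, ← ofReal_norm, ENNReal.ofReal_lt_one] at hy
      simpa [FormalMultilinearSeries.ofScalars_apply_eq, mul_comm] using hf y hy'
  have hd' : DiffContOnCl ℂ f (ball 0 r) :=
    (hd.mono (closedBall_subset_ball hr1)).diffContOnCl_ball subset_rfl
  have hcp := DiffContOnCl.hasFPowerSeriesOnBall (R := ⟨r, hr0.le⟩) hd' hr0
  have heq := hps.hasFPowerSeriesAt.eq_formalMultilinearSeries hcp.hasFPowerSeriesAt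
  rw [← FormalMultilinearSeries.ofScalars_norm (𝕜 := ℂ) (E := ℂ), heq]
  refine (norm_cauchyPowerSeries_le _ _ _ _).trans ?_
  change _ * |r|⁻¹ ^ m ≤ _
  rw [abs_of_pos hr0]
  gcongr
  have hi : ∫ θ in (0 : ℝ)..2 * Real.pi, ‖f (circleMap 0 r θ)‖ ≤
      ∫ θ in (0 : ℝ)..2 * Real.pi, B := by
    refine intervalIntegral.integral_mono (by positivity) ?_ (by simp) fun θ =>
      hB _ (circleMap_mem_sphere 0 hr0.le θ)
    have hc : ContinuousOn f (sphere 0 r) :=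
      hd.continuousOn.mono (sphere_subset_closedBall.trans (closedBall_subset_ball hr1))
    exact (hc.norm.circleIntegrable hr0.le)
  rw [intervalIntegral.integral_const, smul_eq_mul, sub_zero] at hi
  calc (2 * Real.pi)⁻¹ * _ ≤ (2 * Real.pi)⁻¹ * (2 * Real.pi * B) := by gcongr; exact hi
    _ = B := by field_simp

/-- An upper bound for `joukProd` in the disc bounds its logarithm. -/
theorem exists_norm_logProd_le {C r : ℝ} (hC : 0 < C) (hr0 : 0 ≤ r) (hr1 : r < 1) :
    ∃ B, ∀ R : Multiset ℂ, (∀ η ∈ R, η ∈ E) →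
      (∀ w, ‖w‖ < 1 → ‖joukProd R w‖ ^ 2 ≤ C / (1 - ‖w‖) ^ 3) →
      ∀ w, ‖w‖ ≤ r → ‖logProd R w‖ ≤ B := by
  -- Borel–Carathéodory needs a bound for the real part on a larger disc, still inside the unit
  -- disc.
  set ρ := (1 + r) / 2 with hρ
  have hρ1 : ρ < 1 := by linarith
  have hρ0 : 0 < ρ := by linarith
  have hrρ : r < ρ := by linarith
  have hp : 0 < 1 - ρ := by linarith
  set M := |Real.log (C / (1 - ρ) ^ 3)| + 1 with hM
  have hM0 : 0 < M := by positivity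
  refine ⟨2 * M * r / (ρ - r), fun R hR hb w hw => ?_⟩
  have hmaps : Set.MapsTo (logProd R) (ball 0 ρ) {z | z.re ≤ M} := by
    intro u hu
    have hu' : ‖u‖ < ρ := by simpa using hu
    have hu1 : ‖u‖ < 1 := hu'.trans hρ1
    have h1 : Real.exp (logProd R u).re ^ 2 ≤ C / (1 - ρ) ^ 3 := by
      rw [re_logProd hR hu1]
      refine (hb u hu1).trans ?_
      gcongr
    rw [← Real.exp_nat_mul] at h1
    have h2 := (Real.le_log_iff_exp_le (by positivity)).2 h1
    have h3 := le_abs_self (Real.log (C / (1 - ρ) ^ 3))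
    have h4 := abs_nonneg (Real.log (C / (1 - ρ) ^ 3))
    push_cast at h2
    change (logProd R u).re ≤ M
    linarith
  have h := Complex.borelCaratheodory_zero hM0
    ((differentiableOn_logProd hR).mono (ball_subset_ball hρ1.le)) hmaps hρ0
    (z := w) (by simpa using hw.trans_lt hrρ) (logProd_zero R)
  refine h.trans ?_
  have : 0 < ρ - r := by linarith
  gcongr

/-- The sum is, up to `-2/m`, the `m`-th Taylor coefficient of `logProd R`, which is bounded on `|w|
= 1/2` independently of `R`. Hence the bound does not grow with the number of points. -/
theorem exists_norm_sum_T_le {C : ℝ} (hC : 0 < C) {m : ℕ} (hm : m ≠ 0) :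
    ∃ B, ∀ R : Multiset ℂ, (∀ η ∈ R, η ∈ E) →
      (∀ w, ‖w‖ < 1 → ‖joukProd R w‖ ^ 2 ≤ C / (1 - ‖w‖) ^ 3) →
      ‖(R.map fun η => (Polynomial.Chebyshev.T ℂ m).eval η).sum‖ ≤ B := by
  obtain ⟨B, hB⟩ := exists_norm_logProd_le hC (r := 1 / 2) (by norm_num) (by norm_num)
  refine ⟨B * (1 / 2 : ℝ)⁻¹ ^ m * m, fun R hR hb => ?_⟩
  have hT : ∀ j : ℕ, ‖(R.map fun η => (Polynomial.Chebyshev.T ℂ j).eval η).sum‖ ≤ R.card := by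
    intro j
    refine (norm_multiset_sum_le _).trans ?_
    rw [Multiset.map_map, ← nsmul_one R.card, ← Multiset.card_map
      (norm ∘ fun η => (Polynomial.Chebyshev.T ℂ j).eval η) R]
    refine Multiset.sum_le_card_nsmul _ _ fun x hx => ?_
    obtain ⟨η, hη, rfl⟩ := Multiset.mem_map.1 hx
    exact norm_eval_T_le (hR η hη) j
  have h := norm_coeff_le_of_hasSum
    (a := fun j : ℕ => -(2 * (R.map fun η => (Polynomial.Chebyshev.T ℂ j).eval η).sum) / j)
    -- This crude bound only secures convergence in the unit disc; it does not enter the resulting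
    -- estimate.
    (A := 2 * R.card) (fun j => by
      rcases Nat.eq_zero_or_pos j with rfl | hj
      · simp
      · rw [norm_div, norm_neg, norm_mul, Complex.norm_ofNat, Complex.norm_natCast]
        refine (div_le_self (by positivity) (by exact_mod_cast hj)).trans ?_
        gcongr
        exact hT j)
    (fun w hw => hasSum_logProd hR hw) (r := 1 / 2) (B := B) (by norm_num) (by norm_num)
    (differentiableOn_logProd hR)
    (fun w hw => hB R hR hb w (mem_sphere_zero_iff_norm.1 hw).le) m
  have hm0 : (0 : ℝ) < m := by exact_mod_cast Nat.pos_of_ne_zero hm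
  rw [norm_div, norm_neg, norm_mul, Complex.norm_ofNat, Complex.norm_natCast,
    div_le_iff₀ hm0] at h
  have := norm_nonneg (R.map fun η => (Polynomial.Chebyshev.T ℂ m).eval η).sum
  linarith

end PadeModel
end

/-! ### From bounded Chebyshev sums to the arcsine distribution. -/

noncomputable section
namespace PadeModel
open Complex Filter MeasureTheory Metric

theorem integrable_and_integral_sum_dirac (h : ℂ →ᵇ ℝ) (R : Multiset ℂ) :
    Integrable h (R.map fun η : ℂ => Measure.dirac η).sum ∧
      ∫ t, h t ∂(R.map fun η : ℂ => Measure.dirac η).sum = (R.map h).sum := by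
  induction R using Multiset.induction_on with
  | empty => simp
  | cons η R ih =>
    have hd : Integrable h (Measure.dirac η) := integrable_dirac (by simp)
    simp only [Multiset.map_cons, Multiset.sum_cons]
    refine ⟨hd.add_measure ih.1, ?_⟩
    rw [integral_add_measure hd ih.1, ih.2, integral_dirac]

/-- The sequence of Chebyshev polynomials, which spans all polynomials. -/
def chebyshevSequence : Polynomial.Sequence ℝ where
  elems' m := Polynomial.Chebyshev.T ℝ m
  degree_eq' m := by rw [Polynomial.Chebyshev.degree_T]; simp

theorem span_T_eq_top :
    Submodule.span ℝ (Set.range fun m : ℕ => Polynomial.Chebyshev.T ℝ m) = ⊤ := by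
  refine chebyshevSequence.span fun m => ?_
  change IsUnit (Polynomial.Chebyshev.T ℝ m).leadingCoeff
  rw [Polynomial.Chebyshev.leadingCoeff_T]
  exact (pow_ne_zero _ two_ne_zero).isUnit

theorem integral_T_arcsine {m : ℕ} (hm : m ≠ 0) :
    ∫ t : ℂ, (Polynomial.Chebyshev.T ℝ m).eval t.re ∂arcsine = 0 := by
  have hc : Continuous fun t : ℂ => (Polynomial.Chebyshev.T ℝ m).eval t.re := by fun_prop
  rw [arcsine_eq_map_measureT, integral_map (by fun_prop) hc.aestronglyMeasurable,
    integral_smul_measure]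
  simp only [ofReal_re]
  rw [Polynomial.Chebyshev.integral_eval_T_real_measureT_of_ne_zero (by exact_mod_cast hm),
    smul_zero]

theorem ae_mem_E : ∀ᵐ t ∂arcsine, t ∈ E := measure_eq_zero_iff_ae_notMem.1 arcsine_compl_E |>.mono
  fun _ h => not_not.1 h

theorem integrable_arcsine {f : ℂ → ℝ} (hf : Continuous f) : Integrable f arcsine := by
  obtain ⟨M, hM⟩ := isCompact_E.exists_bound_of_continuousOn hf.continuousOn
  exact Integrable.of_bound hf.aestronglyMeasurable M (ae_mem_E.mono hM)

/-- By linearity only the `T_m` matter. For `m = 0` the sum counts the points; for `m ≥ 1` the mean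
is `O(1/n)` and the arcsine integral vanishes. -/
theorem tendsto_sum_polynomial {R : ℕ → Multiset ℂ} (hcard : ∀ n, (R n).card = n)
    (hT : ∀ m : ℕ, m ≠ 0 → ∃ B : ℝ, ∀ n,
      |((R n).map fun η => (Polynomial.Chebyshev.T ℝ m).eval η.re).sum| ≤ B) (p : ℝ[X]) :
    Tendsto (fun n : ℕ => (n : ℝ)⁻¹ * ((R n).map fun η => p.eval η.re).sum) atTop
      (𝓝 (∫ t : ℂ, p.eval t.re ∂arcsine)) := by
  have hp : p ∈ Submodule.span ℝ (Set.range fun m : ℕ => Polynomial.Chebyshev.T ℝ m) := by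
    rw [span_T_eq_top]; trivial
  induction hp using Submodule.span_induction with
  | mem p hp =>
    obtain ⟨m, rfl⟩ := hp
    rcases eq_or_ne m 0 with rfl | hm
    · simp only [Nat.cast_zero, Polynomial.Chebyshev.T_zero, Polynomial.eval_one, integral_const,
        probReal_univ, smul_eq_mul, mul_one, Multiset.map_const', Multiset.sum_replicate, hcard,
        nsmul_eq_mul]
      refine tendsto_const_nhds.congr' ?_
      filter_upwards [eventually_gt_atTop 0] with n hn
      rw [inv_mul_cancel₀]
      exact_mod_cast hn.ne'
    · rw [integral_T_arcsine hm]
      obtain ⟨B, hB⟩ := hT m hm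
      have h0 : Tendsto (fun n : ℕ => (n : ℝ)⁻¹ * B) atTop (𝓝 0) := by
        simpa using (tendsto_inv_atTop_nhds_zero_nat (𝕜 := ℝ)).mul_const B
      refine squeeze_zero_norm (fun n => ?_) h0
      rw [norm_mul, Real.norm_of_nonneg (by positivity)]
      gcongr
      exact hB n
  | zero => simp
  | add p q _ _ hp hq =>
    simp only [Polynomial.eval_add, Multiset.sum_map_add, mul_add]
    rw [integral_add (integrable_arcsine (by fun_prop)) (integrable_arcsine (by fun_prop))]
    exact hp.add hq
  | smul c p _ hp =>
    simp only [Polynomial.eval_smul, smul_eq_mul, Multiset.sum_map_mul_left]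
    rw [integral_const_mul]
    refine (hp.const_mul c).congr fun n => ?_
    ring

theorem abs_sum_sub_sum_le {R : Multiset ℂ} {f g : ℂ → ℝ} {ε : ℝ}
    (h : ∀ η ∈ R, |f η - g η| ≤ ε) : |(R.map f).sum - (R.map g).sum| ≤ R.card * ε := by
  induction R using Multiset.induction_on with
  | empty => simp
  | cons η R ih =>
    have h1 := h η (by simp)
    have h2 := ih fun ξ hξ => h ξ (by simp [hξ])
    simp only [Multiset.map_cons, Multiset.sum_cons, Multiset.card_cons]
    push_cast
    rw [abs_le] at h1 h2 ⊢
    constructor <;> linarith [h1.1, h1.2, h2.1, h2.2]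

/-- Points of `[-1, 1]` whose Chebyshev sums are bounded have the arcsine distribution. -/
theorem tendsto_sum_arcsine {R : ℕ → Multiset ℂ} (hcard : ∀ n, (R n).card = n)
    (hE : ∀ n, ∀ η ∈ R n, η ∈ E)
    (hT : ∀ m : ℕ, m ≠ 0 → ∃ B : ℝ, ∀ n,
      |((R n).map fun η => (Polynomial.Chebyshev.T ℝ m).eval η.re).sum| ≤ B) (h : ℂ →ᵇ ℝ) :
    Tendsto (fun n : ℕ => (n : ℝ)⁻¹ * ((R n).map h).sum) atTop (𝓝 (∫ t, h t ∂arcsine)) := by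
  rw [Metric.tendsto_atTop]
  intro ε hε
  obtain ⟨p, hp⟩ := exists_polynomial_near_of_continuousOn (-1) 1 (fun x : ℝ => h (x : ℂ))
    (by fun_prop) (ε / 4) (by positivity)
  have hpE : ∀ η ∈ E, |h η - p.eval η.re| ≤ ε / 4 := by
    rintro _ ⟨x, hx, rfl⟩
    rw [abs_sub_comm]
    exact (hp x hx).le
  obtain ⟨N, hN⟩ := Metric.tendsto_atTop.1 (tendsto_sum_polynomial hcard hT p) (ε / 4)
    (by positivity)
  refine ⟨N + 1, fun n hn => ?_⟩
  have h1 := hN n (by omega)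
  have h2 := abs_sum_sub_sum_le (R := R n) (f := h) (g := fun η => p.eval η.re)
    fun η hη => hpE η (hE n η hη)
  rw [hcard] at h2
  have hn0 : (0 : ℝ) < n := by exact_mod_cast (by omega : 0 < n)
  have h3 : |(n : ℝ)⁻¹ * ((R n).map h).sum - (n : ℝ)⁻¹ * ((R n).map fun η => p.eval η.re).sum| ≤
      ε / 4 := by
    rw [← mul_sub, abs_mul, abs_of_pos (inv_pos.2 hn0)]
    calc _ ≤ (n : ℝ)⁻¹ * (n * (ε / 4)) := by gcongr
      _ = ε / 4 := by field_simp
  have h4 : |∫ t, h t ∂arcsine - ∫ t : ℂ, p.eval t.re ∂arcsine| ≤ ε / 4 := by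
    rw [← integral_sub (integrable_arcsine h.continuous) (integrable_arcsine (by fun_prop))]
    have := norm_integral_le_of_norm_le_const (μ := arcsine)
      (f := fun t : ℂ => h t - p.eval t.re) (C := ε / 4) (ae_mem_E.mono hpE)
    simpa using this
  rw [Real.dist_eq] at h1 ⊢
  rw [abs_le] at h3 h4
  rw [abs_lt] at h1 ⊢
  constructor <;> linarith [h1.1, h1.2, h3.1, h3.2, h4.1, h4.2]

theorem weakStarTendsto_zeroCount {p : ℕ → ℂ[X]} (hcard : ∀ n, (p n).roots.card = n)
    (hE : ∀ n, ∀ η ∈ (p n).roots, η ∈ E) {C : ℝ} (hC : 0 < C)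
    (hb : ∀ n w, ‖w‖ < 1 → ‖joukProd (p n).roots w‖ ^ 2 ≤ C / (1 - ‖w‖) ^ 3) :
    WeakStarTendsto (fun n => (n : ENNReal)⁻¹ • zeroCount (p n)) arcsine := by
  intro h
  have hT : ∀ m : ℕ, m ≠ 0 → ∃ B : ℝ, ∀ n,
      |((p n).roots.map fun η => (Polynomial.Chebyshev.T ℝ m).eval η.re).sum| ≤ B := by
    intro m hm
    obtain ⟨B, hB⟩ := exists_norm_sum_T_le hC hm
    refine ⟨B, fun n => ?_⟩
    have h1 := hB (p n).roots (hE n) (hb n)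
    have h2 : ((p n).roots.map fun η => (Polynomial.Chebyshev.T ℂ m).eval η).sum =
        ((((p n).roots.map fun η => (Polynomial.Chebyshev.T ℝ m).eval η.re).sum : ℝ) : ℂ) := by
      rw [← Complex.ofRealHom_eq_coe, map_multiset_sum, Multiset.map_map]
      congr 1
      refine Multiset.map_congr rfl fun η hη => ?_
      have := Polynomial.Chebyshev.algebraMap_eval_T (R' := ℂ) η.re m
      conv_lhs => rw [← (mem_E_re (hE n η hη)).2]
      exact this.symm
    rwa [h2, norm_real, Real.norm_eq_abs] at h1
  refine (tendsto_sum_arcsine hcard hE hT h).congr fun n => ?_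
  -- At `n = 0` the weight is `⊤`, whose real value 0 matches the real inverse of 0.
  rw [integral_smul_measure, zeroCount, (integrable_and_integral_sum_dirac h _).2]
  simp

end PadeModel
end

/-! ### Two-sided bounds for the Padé error and their `N`-th roots. -/

noncomputable section
namespace PadeModel
open Complex Filter MeasureTheory Metric

variable {k : ℂ → ℝ}

theorem IsPadePair.isOrthogonal {F : ℂ → ℂ} (h : HasPositiveJump F k) {n : ℕ} {P Q : ℂ[X]}
    (hPQ : IsPadePair (fun z => F (invPhi (recip z))) n P Q) :
    IsOrthogonal k n (Q.reflect n) where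
  ne_zero := by rw [Ne, Polynomial.reflect_eq_zero_iff]; exact hPQ.1
  natDegree_le := (Polynomial.natDegree_reflect_le).trans (by simpa using hPQ.2.2.1)
  sig_mul_pow := (hPQ.orthogonality h).1

theorem IsOrthogonal.eval_ne_zero (hk : ContinuousOn k (sphere 0 1))
    (hpos : ∀ s ∈ sphere (0 : ℂ) 1, 0 < k s) {n : ℕ} {q : ℂ[X]} (hq : IsOrthogonal k n q)
    {z : ℂ} (hz : z ∉ E) : q.eval z ≠ 0 := fun h0 =>
  hz (hq.mem_E_of_mem_roots hk hpos ((Polynomial.mem_roots hq.ne_zero).2 h0))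

theorem eval_zero_eq_coeff_reflect (n : ℕ) (Q : ℂ[X]) : Q.eval 0 = (Q.reflect n).coeff n := by
  rw [Polynomial.coeff_reflect, Polynomial.revAt_le le_rfl, Nat.sub_self,
    Polynomial.coeff_zero_eq_eval_zero]

/-- The Padé denominators do not vanish on `D`. -/
theorem IsPadePair.eval_coord_ne_zero {F : ℂ → ℂ} (h : HasPositiveJump F k) {n : ℕ} {P Q : ℂ[X]}
    (hPQ : IsPadePair (fun z => F (invPhi (recip z))) n P Q) {ζ : OnePoint ℂ} (hζ : ζ ∈ D) :
    Q.eval (coord ζ) ≠ 0 := by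
  have ho := hPQ.isOrthogonal h
  induction ζ using OnePoint.rec with
  | infty =>
    change Q.eval 0 ≠ 0
    rw [eval_zero_eq_coeff_reflect n]
    have hd := ho.natDegree_eq h.continuousOn h.pos
    have := Polynomial.leadingCoeff_ne_zero.2 ho.ne_zero
    rwa [Polynomial.leadingCoeff, hd] at this
  | coe z =>
    change Q.eval z⁻¹ ≠ 0
    have hz := coe_mem_D.1 hζ
    have hz0 : z ≠ 0 := fun h => hz (h ▸ zero_mem_E)
    have := ho.eval_ne_zero h.continuousOn h.pos hz
    rw [eval_reflect hPQ.2.2.1 hz0] at this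
    exact right_ne_zero_of_mul this

theorem exists_ofReal_prod_sub {R : Multiset ℂ} (hR : ∀ η ∈ R, η ∈ E) (x : ℝ) :
    ∃ t : ℝ, (R.map fun η => (x : ℂ) - η).prod = t := by
  induction R using Multiset.induction_on with
  | empty => exact ⟨1, by simp⟩
  | cons η R ih =>
    obtain ⟨t, ht⟩ := ih fun ξ hξ => hR ξ (by simp [hξ])
    refine ⟨(x - η.re) * t, ?_⟩
    rw [Multiset.map_cons, Multiset.prod_cons, ht, ← (mem_E_re (hR η (by simp))).2]
    simp

/-- All zeros are real, so on the real line `q` is a real polynomial times its leading coefficient.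
Up to a unimodular constant, `q² dσ` is thus a positive measure. -/
theorem sq_eval_eq {q : ℂ[X]} (hq : q ≠ 0) (hR : ∀ η ∈ q.roots, η ∈ E) (x : ℝ) :
    q.eval (x : ℂ) ^ 2 =
      (q.leadingCoeff ^ 2 / (‖q.leadingCoeff‖ : ℂ) ^ 2) * ((‖q.eval (x : ℂ)‖ ^ 2 : ℝ) : ℂ) := by
  obtain ⟨t, ht⟩ := exists_ofReal_prod_sub hR x
  have hl : (‖q.leadingCoeff‖ : ℂ) ≠ 0 := by
    simpa using hq
  rw [(IsAlgClosed.splits q).eval_eq_prod_roots, ht, norm_mul, norm_real, Real.norm_eq_abs, mul_pow,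
    mul_pow, sq_abs]
  push_cast
  field_simp

/-- The remainder, in terms of the square of the orthogonal polynomial. -/
theorem IsPadePair.eval_mul_remainder {F : ℂ → ℂ} (h : HasPositiveJump F k) {n : ℕ} {P Q : ℂ[X]}
    (hPQ : IsPadePair (fun z => F (invPhi (recip z))) n P Q) {z : ℂ} (hz : z ∉ E) :
    (Q.reflect n).eval z * ((Q.reflect n).eval z * F (phi z)⁻¹ - (P.reflect n).eval z) =
      sig k fun x => (Q.reflect n).eval (x : ℂ) ^ 2 / (z - x) := by
  have hk := h.continuousOn
  have ho := hPQ.isOrthogonal h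
  rw [(hPQ.orthogonality h).2 z hz]
  set q := Q.reflect n
  -- Replacing `q(z)` by `q(x)` under the integral changes it by `∫ q d dσ`, where `d` is the
  -- divided difference of degree below `n`; orthogonality makes this zero.
  obtain ⟨d, hd⟩ := (Polynomial.dvd_iff_isRoot (a := z) (p := q - Polynomial.C (q.eval z))).2
    (by simp)
  have hdx : ∀ x : ℝ, q.eval (x : ℂ) - q.eval z = (x - z) * d.eval (x : ℂ) := fun x => by
    simpa using congrArg (Polynomial.eval (x : ℂ)) hd
  have hdeg : d.degree < n := by
    by_cases hd0 : d = 0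
    · rw [hd0, Polynomial.degree_zero]
      exact WithBot.bot_lt_coe n
    rw [← Polynomial.natDegree_lt_iff_degree_lt hd0]
    have h1 := congrArg Polynomial.natDegree hd
    rw [Polynomial.natDegree_sub_C, Polynomial.natDegree_mul (Polynomial.X_sub_C_ne_zero z) hd0,
      Polynomial.natDegree_X_sub_C, ho.natDegree_eq hk h.pos] at h1
    omega
  have h0 := ho.sig_mul hk hdeg
  rw [← sig_const_mul, ← sub_zero (sig k _), ← h0, ← sig_sub hk]
  · refine sig_congr fun x hx => ?_
    have hne := sub_ofReal_ne_zero hz hx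
    have := hdx x
    rw [eq_div_iff hne]
    rw [sub_mul, mul_assoc, div_mul_cancel₀ _ hne]
    linear_combination (-q.eval (x : ℂ)) * this
  · exact continuousOn_const.mul (continuousOn_div_sub hz (by fun_prop))
  · fun_prop

theorem norm_one_sub_two_mul_add_sq_ge {x : ℝ} (hx : -1 ≤ x ∧ x ≤ 1) {w : ℂ} (hw : ‖w‖ < 1) :
    (1 - ‖w‖) ^ 2 ≤ ‖1 - 2 * (x : ℂ) * w + w ^ 2‖ := by
  have h : ∀ s : ℂ, ‖s‖ = 1 → 1 - ‖w‖ ≤ ‖1 - w * s‖ := fun s hs => by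
    have := norm_sub_norm_le (1 : ℂ) (w * s)
    rwa [norm_one, norm_mul, hs, mul_one] at this
  rw [one_sub_two_mul_add_sq_eq_lift hx, norm_mul, sq]
  exact mul_le_mul (h _ (norm_lift hx)) (h _ (by rw [norm_conj, norm_lift hx])) (by linarith)
    (norm_nonneg _)

theorem norm_one_sub_two_mul_add_sq_le {x : ℝ} (hx : -1 ≤ x ∧ x ≤ 1) {w : ℂ} (hw : ‖w‖ < 1) :
    ‖1 - 2 * (x : ℂ) * w + w ^ 2‖ ≤ 4 := by
  have h : ∀ s : ℂ, ‖s‖ = 1 → ‖1 - w * s‖ ≤ 2 := fun s hs => by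
    have := norm_sub_le (1 : ℂ) (w * s)
    rw [norm_one, norm_mul, hs, mul_one] at this
    linarith
  rw [one_sub_two_mul_add_sq_eq_lift hx, norm_mul]
  exact (mul_le_mul (h _ (norm_lift hx)) (h _ (by rw [norm_conj, norm_lift hx])) (norm_nonneg _)
    (by norm_num)).trans (by norm_num)

/-- The quotient is the mean of the Herglotz kernels `(1 + wℓ)/(1 - wℓ)` at the two conjugate lifts,
whose real parts are Poisson kernels. The positive real part rules out cancellation in the remainder
integral. -/
theorem re_one_sub_sq_div_ge {x : ℝ} (hx : -1 ≤ x ∧ x ≤ 1) {w : ℂ} (hw : ‖w‖ < 1) :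
    (1 - ‖w‖) ^ 3 / 16 ≤ ((1 - w ^ 2) / (1 - 2 * (x : ℂ) * w + w ^ 2)).re := by
  set d := 1 - 2 * (x : ℂ) * w + w ^ 2 with hd
  have hd0 : d ≠ 0 := one_sub_two_mul_add_sq_ne_zero hx hw
  have hdn : 0 < normSq d := normSq_pos.2 hd0
  have hd16 : normSq d ≤ 16 := by
    rw [normSq_eq_norm_sq]
    have := norm_one_sub_two_mul_add_sq_le hx hw
    nlinarith [norm_nonneg d]
  have hw0 := norm_nonneg w
  have hnum : ((1 - w ^ 2) * (starRingEnd ℂ) d).re =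
      (1 - ‖w‖ ^ 2) * (1 + ‖w‖ ^ 2 - 2 * x * w.re) := by
    rw [← normSq_eq_norm_sq, normSq_apply]
    simp [hd, sq]
    ring
  have hge : (1 - ‖w‖) ^ 3 ≤ ((1 - w ^ 2) * (starRingEnd ℂ) d).re := by
    rw [hnum]
    have h1 : x * w.re ≤ ‖w‖ := by
      have h2 : |x * w.re| ≤ 1 * ‖w‖ := by
        rw [abs_mul]
        exact mul_le_mul (abs_le.2 hx) (abs_re_le_norm w) (abs_nonneg _) zero_le_one
      linarith [le_abs_self (x * w.re)]
    calc (1 - ‖w‖) ^ 3 = (1 - ‖w‖) * (1 - ‖w‖) ^ 2 := by ring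
      _ ≤ (1 - ‖w‖ ^ 2) * (1 + ‖w‖ ^ 2 - 2 * x * w.re) := by
        apply mul_le_mul
        · nlinarith
        · nlinarith
        · positivity
        · nlinarith
  have he : ((1 - w ^ 2) / d).re = ((1 - w ^ 2) * (starRingEnd ℂ) d).re / normSq d := by
    rw [div_eq_mul_inv, Complex.inv_def, ← mul_assoc, re_mul_ofReal]
    rfl
  rw [he]
  have : 0 ≤ (1 - ‖w‖) ^ 3 := pow_nonneg (by linarith) 3
  exact div_le_div₀ (this.trans hge) hge hdn hd16

theorem norm_sig_div_le (hk : ContinuousOn k (sphere 0 1))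
    (hpos : ∀ s ∈ sphere (0 : ℂ) 1, 0 < k s) (q : ℂ[X]) {w : ℂ} (hw : ‖w‖ < 1) :
    ‖sig k fun x => ((‖q.eval (x : ℂ)‖ ^ 2 : ℝ) : ℂ) / (1 - 2 * (x : ℂ) * w + w ^ 2)‖ ≤
      ((1 - ‖w‖) ^ 2)⁻¹ * rsig k fun x => ‖q.eval (x : ℂ)‖ ^ 2 := by
  rw [← rsig_const_mul]
  refine norm_sig_le hk hpos (by fun_prop) fun x hx => ?_
  have h := norm_one_sub_two_mul_add_sq_ge hx hw
  have hp : 0 < (1 - ‖w‖) ^ 2 := pow_pos (by linarith) 2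
  rw [norm_div, norm_real, Real.norm_of_nonneg (by positivity), div_eq_inv_mul]
  gcongr

/-- Multiplication by `1 - w²` gives the integrand a positive real part; undoing it costs the factor
`‖1 - w²‖ ≤ 2`, whence 32 instead of 16. -/
theorem le_norm_sig_div (hk : ContinuousOn k (sphere 0 1))
    (hpos : ∀ s ∈ sphere (0 : ℂ) 1, 0 < k s) (q : ℂ[X]) {w : ℂ} (hw : ‖w‖ < 1) :
    (1 - ‖w‖) ^ 3 / 32 * rsig k (fun x => ‖q.eval (x : ℂ)‖ ^ 2) ≤
      ‖sig k fun x => ((‖q.eval (x : ℂ)‖ ^ 2 : ℝ) : ℂ) / (1 - 2 * (x : ℂ) * w + w ^ 2)‖ := by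
  set S := sig k fun x => ((‖q.eval (x : ℂ)‖ ^ 2 : ℝ) : ℂ) / (1 - 2 * (x : ℂ) * w + w ^ 2) with hS
  have hcont : ContinuousOn (fun x : ℝ => (1 - w ^ 2) *
      (((‖q.eval (x : ℂ)‖ ^ 2 : ℝ) : ℂ) / (1 - 2 * (x : ℂ) * w + w ^ 2))) (Set.Icc (-1) 1) :=
    continuousOn_const.mul (ContinuousOn.div (by fun_prop) (by fun_prop)
      fun _ hx => one_sub_two_mul_add_sq_ne_zero hx hw)
  have h1 : (1 - ‖w‖) ^ 3 / 16 * rsig k (fun x => ‖q.eval (x : ℂ)‖ ^ 2) ≤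
      ((1 - w ^ 2) * S).re := by
    rw [hS, ← sig_const_mul, ← rsig_const_mul, sig, re_circleAverage (continuousOn_sig hk hcont)]
    refine circleAverage_le
      (continuousOn_rsig hk (f := fun x => (1 - ‖w‖) ^ 3 / 16 * ‖q.eval (x : ℂ)‖ ^ 2)
        (by fun_prop))
      (Complex.continuous_re.comp_continuousOn (continuousOn_sig hk hcont)) fun s hs => ?_
    have h0 : 0 ≤ s.im ^ 2 * k s := mul_nonneg (sq_nonneg _) (hpos s hs).le
    rw [re_mul_ofReal]
    refine mul_le_mul_of_nonneg_right ?_ h0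
    have h2 := re_one_sub_sq_div_ge (re_mem_Icc hs) hw
    rw [← mul_div_assoc, mul_comm (1 - w ^ 2), mul_div_assoc, Complex.re_ofReal_mul]
    refine (mul_comm _ _).trans_le ?_
    exact mul_le_mul_of_nonneg_left h2 (by positivity)
  have h2 : ‖1 - w ^ 2‖ ≤ 2 := by
    have := norm_sub_le (1 : ℂ) (w ^ 2)
    rw [norm_one, norm_pow] at this
    nlinarith [norm_nonneg w]
  have h3 := (re_le_norm _).trans_eq (norm_mul (1 - w ^ 2) S)
  have h4 : ‖1 - w ^ 2‖ * ‖S‖ ≤ 2 * ‖S‖ := by gcongr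
  linarith

/-- Covers the point at infinity, where the error and its bounds all vanish. -/
theorem IsPadePair.eval_zero {F : ℂ → ℂ} {n : ℕ} {P Q : ℂ[X]}
    (hPQ : IsPadePair (fun z => F (invPhi (recip z))) n P Q) :
    Q.eval 0 * F 0 = P.eval 0 := by
  obtain ⟨C, hC⟩ := hPQ.2.2.2.bound
  have := hC.self_of_nhds
  have hr : invPhi (recip 0) = 0 := by simp [recip, invPhi]
  simp only [hr] at this
  simpa [sub_eq_zero] using this

/-- Two-sided bounds for the error of the Padé approximants on compact subsets of `D`. -/
theorem exists_remainder_bounds {F : ℂ → ℂ} (h : HasPositiveJump F k) {r : ℝ} (hr0 : 0 ≤ r)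
    (hr1 : r < 1) :
    ∃ c > 0, ∃ C > 0, ∀ (n : ℕ) (P Q : ℂ[X]),
      IsPadePair (fun z => F (invPhi (recip z))) n P Q →
      ∀ ζ ∈ D, ‖invPhi ζ‖ ≤ r →
        c * ‖invPhi ζ‖ ^ (2 * n + 1) ≤
            ‖F (invPhi ζ) - P.eval (coord ζ) / Q.eval (coord ζ)‖ ∧
          ‖F (invPhi ζ) - P.eval (coord ζ) / Q.eval (coord ζ)‖ ≤
            C * ‖invPhi ζ‖ ^ (2 * n + 1) := by
  have hk := h.continuousOn
  obtain ⟨c₀, hc₀, hck⟩ := exists_pos_le_on_sphere hk h.pos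
  obtain ⟨C₀, hC₀, hjouk⟩ := exists_norm_joukProd_le hk h.pos
  obtain ⟨B, hB⟩ := exists_norm_logProd_le hC₀ hr0 hr1
  have hM : 0 < rsig k fun _ => 1 := by
    simpa using rsig_pos hk h.pos (one_ne_zero (α := ℂ[X]))
  set M := rsig k fun _ => 1
  have hr : 0 < 1 - r := by linarith
  refine ⟨2 * ((1 - r) ^ 3 / 32 * (c₀ / 4)) / Real.exp B ^ 2, by positivity,
    2 * (((1 - r) ^ 2)⁻¹ * (4 * M)) / Real.exp (-B) ^ 2, by positivity,
    fun n P Q hPQ ζ hζ hw => ?_⟩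
  have hQ := hPQ.eval_coord_ne_zero h hζ
  induction ζ using OnePoint.rec with
  | infty =>
    change Q.eval 0 ≠ 0 at hQ
    have h0 := hPQ.eval_zero
    have : F (invPhi OnePoint.infty) - P.eval (coord OnePoint.infty) /
        Q.eval (coord OnePoint.infty) = 0 := by
      change F 0 - P.eval 0 / Q.eval 0 = 0
      rw [← h0]
      field_simp
      ring
    rw [this]
    simp [invPhi]
  | coe z =>
    have hz := coe_mem_D.1 hζ
    have hz0 : z ≠ 0 := fun h => hz (h ▸ zero_mem_E)
    have ho := hPQ.isOrthogonal h
    have hrem := hPQ.eval_mul_remainder h hz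
    have hqz := ho.eval_ne_zero hk h.pos hz
    have hinv : invPhi (z : OnePoint ℂ) = (phi z)⁻¹ := by simp [invPhi]
    have hco : coord (z : OnePoint ℂ) = z⁻¹ := rfl
    rw [hinv] at hw ⊢
    rw [hco]
    have hPe := eval_reflect hPQ.2.1 hz0
    have hQe := eval_reflect hPQ.2.2.1 hz0
    have hfrac : P.eval z⁻¹ / Q.eval z⁻¹ = (P.reflect n).eval z / (Q.reflect n).eval z := by
      rw [hPe, hQe, mul_div_mul_left _ _ (pow_ne_zero n hz0)]
    rw [hfrac]
    set q := Q.reflect n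
    set w := (phi z)⁻¹ with hwdef
    have hw1 : ‖w‖ < 1 := hw.trans_lt hr1
    have hER : ∀ η ∈ q.roots, η ∈ E := fun η hη => ho.mem_E_of_mem_roots hk h.pos hη
    have hnd := ho.natDegree_eq hk h.pos
    have hl : 0 < ‖q.leadingCoeff‖ :=
      norm_pos_iff.2 (Polynomial.leadingCoeff_ne_zero.2 ho.ne_zero)
    set S := sig k fun x => ((‖q.eval (x : ℂ)‖ ^ 2 : ℝ) : ℂ) / (1 - 2 * (x : ℂ) * w + w ^ 2) with hS
    set A := rsig k fun x => ‖q.eval (x : ℂ)‖ ^ 2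
    set l := ‖q.leadingCoeff‖
    set R := F w - (P.reflect n).eval z / q.eval z with hR
    have hA0 : 0 < A := rsig_pos hk h.pos ho.ne_zero
    have hnorm : ‖q.eval z‖ ^ 2 * ‖R‖ = 2 * ‖w‖ * ‖S‖ := by
      have e1 : q.eval z ^ 2 * R =
          (q.leadingCoeff ^ 2 / (l : ℂ) ^ 2 * (2 * w)) * S := by
        rw [hS, ← sig_const_mul]
        have : q.eval z ^ 2 * R = q.eval z * (q.eval z * F w - (P.reflect n).eval z) := by
          rw [hR]
          field_simp
        rw [this, hrem]
        refine sig_congr fun x hx => ?_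
        have hke := kernel_eq hz hx
        rw [← hwdef] at hke
        rw [sq_eval_eq ho.ne_zero hER, div_eq_mul_one_div _ (z - (x : ℂ)), ← hke]
        ring
      have e2 := congrArg norm e1
      simp only [norm_mul, norm_div, norm_pow, norm_real, Real.norm_of_nonneg hl.le,
        Complex.norm_ofNat] at e2
      rw [e2]
      change l ^ 2 / l ^ 2 * (2 * ‖w‖) * ‖S‖ = _
      rw [div_self (by positivity), one_mul]
    have hG : l ^ 2 * ‖joukProd q.roots w‖ ^ 2 = 4 ^ n * ‖w‖ ^ (2 * n) * ‖q.eval z‖ ^ 2 := by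
      have e := congrArg norm (leadingCoeff_mul_joukProd q (two_mul_inv_phi (z := z)))
      rw [← hwdef, hnd] at e
      simp only [norm_mul, norm_pow, Complex.norm_ofNat] at e
      change l * _ = _ at e
      rw [← mul_pow, e, mul_pow, ← pow_mul, mul_pow, mul_comm n 2, pow_mul 2 2 n]
      norm_num
    have hup := ho.rsig_upper hk h.pos
    have hlo := rsig_lower hk hck hc₀ hnd
    have hS1 := norm_sig_div_le hk h.pos q hw1
    have hS2 := le_norm_sig_div hk h.pos q hw1
    have hL := hB q.roots hER (hjouk n q ho) w hw
    have hGre := re_logProd hER hw1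
    have hre := abs_le.1 ((abs_re_le_norm _).trans hL)
    have hG1 : Real.exp (-B) ≤ ‖joukProd q.roots w‖ := by
      rw [← hGre]; exact Real.exp_le_exp.2 hre.1
    have hG2 : ‖joukProd q.roots w‖ ≤ Real.exp B := by
      rw [← hGre]; exact Real.exp_le_exp.2 hre.2
    set G := ‖joukProd q.roots w‖
    have hGpos : 0 < G := (Real.exp_pos _).trans_le hG1
    have hq2 : 0 < ‖q.eval z‖ ^ 2 := by positivity
    -- The exact power of `‖w‖` is now isolated: `G` is bounded on both sides by the logarithm
    -- estimate, and `4ⁿ ‖S‖` is comparable to `l²`, so the leading coefficient cancels.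
    have hmain : l ^ 2 * G ^ 2 * ‖R‖ = 2 * ‖w‖ ^ (2 * n + 1) * (4 ^ n * ‖S‖) := by
      rw [hG]
      calc 4 ^ n * ‖w‖ ^ (2 * n) * ‖q.eval z‖ ^ 2 * ‖R‖
          = 4 ^ n * ‖w‖ ^ (2 * n) * (‖q.eval z‖ ^ 2 * ‖R‖) := by ring
        _ = _ := by rw [hnorm]; ring
    have hS1' : 4 ^ n * ‖S‖ ≤ l ^ 2 * (((1 - r) ^ 2)⁻¹ * (4 * M)) := by
      calc 4 ^ n * ‖S‖ ≤ 4 ^ n * (((1 - r) ^ 2)⁻¹ * A) := by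
            gcongr
            exact hS1.trans (by gcongr)
        _ = ((1 - r) ^ 2)⁻¹ * (4 ^ n * A) := by ring
        _ ≤ ((1 - r) ^ 2)⁻¹ * (4 * l ^ 2 * M) := by gcongr
        _ = _ := by ring
    have hS2' : l ^ 2 * ((1 - r) ^ 3 / 32 * (c₀ / 4)) ≤ 4 ^ n * ‖S‖ := by
      calc l ^ 2 * ((1 - r) ^ 3 / 32 * (c₀ / 4)) = (1 - r) ^ 3 / 32 * (c₀ / 4 * l ^ 2) := by ring
        _ ≤ (1 - r) ^ 3 / 32 * (4 ^ n * A) := by gcongr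
        _ = 4 ^ n * ((1 - r) ^ 3 / 32 * A) := by ring
        _ ≤ 4 ^ n * ‖S‖ := by
          gcongr
          refine le_trans ?_ hS2
          gcongr
    have hl2 : 0 < l ^ 2 := by positivity
    have hW : 0 ≤ ‖w‖ ^ (2 * n + 1) := by positivity
    set W := ‖w‖ ^ (2 * n + 1)
    constructor
    · rw [div_mul_eq_mul_div, div_le_iff₀ (by positivity)]
      refine le_trans ?_ (show ‖R‖ * G ^ 2 ≤ ‖R‖ * Real.exp B ^ 2 by gcongr)
      refine le_of_mul_le_mul_left ?_ hl2
      calc l ^ 2 * (2 * ((1 - r) ^ 3 / 32 * (c₀ / 4)) * W)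
          = 2 * W * (l ^ 2 * ((1 - r) ^ 3 / 32 * (c₀ / 4))) := by ring
        _ ≤ 2 * W * (4 ^ n * ‖S‖) := by gcongr
        _ = l ^ 2 * (‖R‖ * G ^ 2) := by rw [← hmain]; ring
    · rw [div_mul_eq_mul_div, le_div_iff₀ (by positivity)]
      refine le_trans (show ‖R‖ * Real.exp (-B) ^ 2 ≤ ‖R‖ * G ^ 2 by gcongr) ?_
      refine le_of_mul_le_mul_left ?_ hl2
      calc l ^ 2 * (‖R‖ * G ^ 2) = 2 * W * (4 ^ n * ‖S‖) := by rw [← hmain]; ring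
        _ ≤ 2 * W * (l ^ 2 * (((1 - r) ^ 2)⁻¹ * (4 * M))) := by gcongr
        _ = _ := by ring

theorem tendsto_rpow_inv_odd {c : ℝ} (hc : 0 < c) :
    Tendsto (fun n : ℕ => c ^ (1 / (2 * (n : ℝ) + 1))) atTop (𝓝 1) := by
  have h1 : Tendsto (fun n : ℕ => 1 / (2 * (n : ℝ) + 1)) atTop (𝓝 0) := by
    have : Tendsto (fun n : ℕ => 2 * (n : ℝ) + 1) atTop atTop :=
      tendsto_atTop_add_const_right _ _
        (tendsto_natCast_atTop_atTop.const_mul_atTop two_pos)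
    exact this.inv_tendsto_atTop.congr fun n => (one_div _).symm
  have h2 := (Real.continuousAt_const_rpow (b := (0 : ℝ)) hc.ne').tendsto.comp h1
  rw [Real.rpow_zero] at h2
  exact h2

/-- `N`-th roots of quantities of geometric size, with `N = 2n + 1`. -/
theorem tendstoUniformlyOn_rpow {X : Type*} {K : Set X} {ρ : X → ℝ} {f : ℕ → X → ℝ} {c C : ℝ}
    (hc : 0 < c) (hC : 0 < C) (h0 : ∀ x ∈ K, 0 ≤ ρ x) (h1 : ∀ x ∈ K, ρ x ≤ 1)
    (hlo : ∀ n, ∀ x ∈ K, c * ρ x ^ (2 * n + 1) ≤ f n x)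
    (hup : ∀ n, ∀ x ∈ K, f n x ≤ C * ρ x ^ (2 * n + 1)) :
    TendstoUniformlyOn (fun n x => f n x ^ (1 / (2 * (n : ℝ) + 1))) ρ atTop K := by
  rw [Metric.tendstoUniformlyOn_iff]
  intro ε hε
  have e1 := Metric.tendsto_nhds.1 (tendsto_rpow_inv_odd hc) ε hε
  have e2 := Metric.tendsto_nhds.1 (tendsto_rpow_inv_odd hC) ε hε
  filter_upwards [e1, e2] with n hn1 hn2 x hx
  have hρ := h0 x hx
  have hρ1 := h1 x hx
  have hroot : ∀ {a : ℝ}, 0 < a → (a * ρ x ^ (2 * n + 1)) ^ (1 / (2 * (n : ℝ) + 1)) =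
      a ^ (1 / (2 * (n : ℝ) + 1)) * ρ x := by
    intro a ha
    rw [Real.mul_rpow ha.le (by positivity)]
    congr 1
    have : 1 / (2 * (n : ℝ) + 1) = ((2 * n + 1 : ℕ) : ℝ)⁻¹ := by push_cast; rw [one_div]
    rw [this, Real.pow_rpow_inv_natCast hρ (by omega)]
  have hL := Real.rpow_le_rpow (by positivity) (hlo n x hx)
    (show 0 ≤ 1 / (2 * (n : ℝ) + 1) by positivity)
  have hU := Real.rpow_le_rpow ((by positivity : 0 ≤ c * ρ x ^ (2 * n + 1)).trans (hlo n x hx))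
    (hup n x hx) (show 0 ≤ 1 / (2 * (n : ℝ) + 1) by positivity)
  rw [hroot hc] at hL
  rw [hroot hC] at hU
  rw [Real.dist_eq, abs_lt] at hn1 hn2 ⊢
  -- Because `ρ ≤ 1`, the deviation of `a^{1/N} ρ` from `ρ` is at most `|a^{1/N} - 1|`, uniformly in
  -- `x` and even where `ρ` vanishes.
  constructor
  · nlinarith
  · nlinarith

end PadeModel
end

/-! ### The model function, its negative reciprocal, and the Padé numerators. -/

noncomputable section
namespace PadeModel
open Complex Filter MeasureTheory Metric

/-- The model function in the variable `w = 1/φ(ζ)`. -/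
def modelFun (A B : ℝ) (w : ℂ) : ℂ := (((A : ℂ) - w) * ((B : ℂ) - w)) ^ (-(1 / 2) : ℂ)

/-- The density factor of the jump of the model function. -/
def modelJump (A B : ℝ) (s : ℂ) : ℝ :=
  (A + B - 2 * s.re) * ‖modelFun A B s‖ ^ 4 / (2 * (modelFun A B s).re)

variable {A B : ℝ}

theorem re_lt_of_norm_le_one (hA : 1 < A) {w : ℂ} (hw : ‖w‖ ≤ 1) : 0 < A - w.re := by
  have := (re_le_norm w).trans hw
  linarith

/-- Both factors have positive real part and the same imaginary part, so the product is real only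
for real `w`, where it is positive. -/
theorem model_mem_slitPlane (hA : 1 < A) (hB : 1 < B) {w : ℂ} (hw : ‖w‖ ≤ 1) :
    ((A : ℂ) - w) * ((B : ℂ) - w) ∈ slitPlane := by
  have h1 := re_lt_of_norm_le_one hA hw
  have h2 := re_lt_of_norm_le_one hB hw
  rw [Complex.mem_slitPlane_iff]
  simp only [mul_re, mul_im, sub_re, sub_im, ofReal_re, ofReal_im, zero_sub]
  by_cases hi : w.im = 0
  · left
    rw [hi]
    have := mul_pos h1 h2
    linarith
  · right
    intro h
    have : w.im * ((A - w.re) + (B - w.re)) = 0 := by linarith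
    rcases mul_eq_zero.1 this with h' | h'
    · exact hi h'
    · linarith

theorem modelFun_sq (hA : 1 < A) (hB : 1 < B) {w : ℂ} (hw : ‖w‖ ≤ 1) :
    modelFun A B w * modelFun A B w * (((A : ℂ) - w) * ((B : ℂ) - w)) = 1 := by
  have h0 := slitPlane_ne_zero (model_mem_slitPlane hA hB hw)
  rw [modelFun, ← Complex.cpow_add _ _ h0, show (-(1 / 2) + -(1 / 2) : ℂ) = -1 by ring,
    Complex.cpow_neg_one, inv_mul_cancel₀ h0]

theorem modelFun_ne_zero (hA : 1 < A) (hB : 1 < B) {w : ℂ} (hw : ‖w‖ ≤ 1) :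
    modelFun A B w ≠ 0 := fun h => by
  simpa [h] using modelFun_sq hA hB hw

theorem modelFun_re_pos (hA : 1 < A) (hB : 1 < B) {w : ℂ} (hw : ‖w‖ ≤ 1) :
    0 < (modelFun A B w).re := by
  have hs := model_mem_slitPlane hA hB hw
  rw [modelFun, show (-(1 / 2) : ℂ) = ((-(1 / 2) : ℝ) : ℂ) by push_cast; rfl,
    Complex.cpow_ofReal_re]
  have hn : 0 < ‖((A : ℂ) - w) * ((B : ℂ) - w)‖ := norm_pos_iff.2 (slitPlane_ne_zero hs)
  have h1 := Complex.neg_pi_lt_arg (((A : ℂ) - w) * ((B : ℂ) - w))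
  have h2 := lt_of_le_of_ne (Complex.arg_le_pi _) (Complex.slitPlane_arg_ne_pi hs)
  refine mul_pos (Real.rpow_pos_of_pos hn _) (Real.cos_pos_of_mem_Ioo ⟨?_, ?_⟩) <;> linarith

theorem modelFun_conj (hA : 1 < A) (hB : 1 < B) {w : ℂ} (hw : ‖w‖ ≤ 1) :
    modelFun A B ((starRingEnd ℂ) w) = (starRingEnd ℂ) (modelFun A B w) := by
  have hs := model_mem_slitPlane hA hB hw
  have h := Complex.conj_cpow (((A : ℂ) - w) * ((B : ℂ) - w)) (-(1 / 2))
    (Complex.slitPlane_arg_ne_pi hs)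
  simp only [map_mul, map_sub, conj_ofReal] at h
  rw [modelFun, h, modelFun]
  congr 2
  simpa using map_ofNat (starRingEnd ℂ) 2

theorem differentiableAt_modelFun (hA : 1 < A) (hB : 1 < B) {w : ℂ} (hw : ‖w‖ ≤ 1) :
    DifferentiableAt ℂ (modelFun A B) w := by
  unfold modelFun
  exact DifferentiableAt.cpow (by fun_prop) (by fun_prop) (model_mem_slitPlane hA hB hw)

/-- Compare imaginary parts in `F² = |F|⁴` times the conjugate of `(A - s)(B - s)`, and divide by `2
Re F > 0`. The factor `Im s` splits off with a positive cofactor. -/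
theorem modelFun_im (hA : 1 < A) (hB : 1 < B) {s : ℂ} (hs : ‖s‖ ≤ 1) :
    (modelFun A B s).im = s.im * modelJump A B s := by
  have hre := modelFun_re_pos hA hB hs
  have hsq := modelFun_sq hA hB hs
  set F := modelFun A B s with hF
  have h1 : F * F = (‖F‖ ^ 4 : ℝ) * (starRingEnd ℂ) (((A : ℂ) - s) * ((B : ℂ) - s)) := by
    have hcc := congrArg (starRingEnd ℂ) hsq
    have hFF : F * (starRingEnd ℂ) F = (‖F‖ ^ 2 : ℝ) := by rw [mul_conj, normSq_eq_norm_sq]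
    simp only [map_mul] at hcc ⊢
    rw [map_one] at hcc
    rw [show ‖F‖ ^ 4 = ‖F‖ ^ 2 * ‖F‖ ^ 2 by ring, ofReal_mul, ← hFF]
    linear_combination (-F * F) * hcc
  have h2 := congrArg Complex.im h1
  rw [Complex.im_ofReal_mul] at h2
  simp only [mul_im, conj_im, sub_re, sub_im, ofReal_re, ofReal_im] at h2
  rw [modelJump, ← hF]
  field_simp
  linarith

theorem hasPositiveJump_modelFun (hA : 1 < A) (hB : 1 < B) :
    HasPositiveJump (modelFun A B) (modelJump A B) where
  diffContOnCl := by
    refine DifferentiableOn.diffContOnCl fun w hw => ?_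
    rw [closure_ball _ one_ne_zero, mem_closedBall_zero_iff] at hw
    exact (differentiableAt_modelFun hA hB hw).differentiableWithinAt
  continuousOn := by
    have hc : ContinuousOn (modelFun A B) (sphere 0 1) := fun w hw =>
      (differentiableAt_modelFun hA hB (mem_sphere_zero_iff_norm.1 hw).le).continuousAt
        |>.continuousWithinAt
    unfold modelJump
    refine ContinuousOn.div ?_ ?_ fun w hw => ?_
    · exact ContinuousOn.mul (by fun_prop) (hc.norm.pow 4)
    · exact continuousOn_const.mul (Complex.continuous_re.comp_continuousOn hc)
    · have := modelFun_re_pos hA hB (mem_sphere_zero_iff_norm.1 hw).le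
      positivity
  pos s hs := by
    have hs1 := (mem_sphere_zero_iff_norm.1 hs).le
    have h1 := modelFun_re_pos hA hB hs1
    have h2 := re_lt_of_norm_le_one hA hs1
    have h3 := re_lt_of_norm_le_one hB hs1
    have h4 : 0 < ‖modelFun A B s‖ := norm_pos_iff.2 (modelFun_ne_zero hA hB hs1)
    have h5 : 0 < A + B - 2 * s.re := by linarith
    unfold modelJump
    positivity
  jump s hs := by
    have hs1 := mem_sphere_zero_iff_norm.1 hs
    rw [inv_eq_conj hs1, modelFun_conj hA hB hs1.le, sub_conj, modelFun_im hA hB hs1.le]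
    push_cast
    ring

/-- The imaginary part of `-1/F` is `Im F / |F|²`; the minus sign keeps the jump positive. -/
theorem hasPositiveJump_neg_inv (hA : 1 < A) (hB : 1 < B) :
    HasPositiveJump (fun w => -(modelFun A B w)⁻¹)
      (fun s => modelJump A B s / ‖modelFun A B s‖ ^ 2) where
  diffContOnCl := ((hasPositiveJump_modelFun hA hB).diffContOnCl.inv fun w hw => by
    rw [closure_ball _ one_ne_zero, mem_closedBall_zero_iff] at hw
    exact modelFun_ne_zero hA hB hw).neg
  continuousOn := by
    have h := hasPositiveJump_modelFun hA hB
    have hc : ContinuousOn (modelFun A B) (sphere 0 1) := fun w hw =>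
      (differentiableAt_modelFun hA hB (mem_sphere_zero_iff_norm.1 hw).le).continuousAt
        |>.continuousWithinAt
    refine h.continuousOn.div (hc.norm.pow 2) fun w hw => ?_
    have := norm_pos_iff.2 (modelFun_ne_zero hA hB (mem_sphere_zero_iff_norm.1 hw).le)
    positivity
  pos s hs := by
    have := norm_pos_iff.2 (modelFun_ne_zero hA hB (mem_sphere_zero_iff_norm.1 hs).le)
    exact div_pos ((hasPositiveJump_modelFun hA hB).pos s hs) (by positivity)
  jump s hs := by
    have hs1 := mem_sphere_zero_iff_norm.1 hs
    have hj := (hasPositiveJump_modelFun hA hB).jump s hs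
    have h0 := modelFun_ne_zero hA hB hs1.le
    rw [inv_eq_conj hs1, modelFun_conj hA hB hs1.le] at hj ⊢
    set F := modelFun A B s
    have hc0 : (starRingEnd ℂ) F ≠ 0 := by simpa using h0
    have hFF : F * (starRingEnd ℂ) F = (‖F‖ ^ 2 : ℝ) := by rw [mul_conj, normSq_eq_norm_sq]
    have hF2 : ((‖F‖ ^ 2 : ℝ) : ℂ) ≠ 0 := hFF ▸ mul_ne_zero h0 hc0
    have e : -F⁻¹ - -((starRingEnd ℂ) F)⁻¹ =
        (F - (starRingEnd ℂ) F) / (F * (starRingEnd ℂ) F) := by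
      field_simp
      ring
    rw [e, hj, hFF, ofReal_div]
    ring

/-- Dividing the contact condition by `F`, which is bounded away from 0, exchanges the roles of
numerator and denominator. -/
theorem IsPadePair.neg_inv (hA : 1 < A) (hB : 1 < B) {n : ℕ} {P Q : ℂ[X]}
    (hPQ : IsPadePair (fun z => modelFun A B (invPhi (recip z))) n P Q) :
    IsPadePair (fun z => -(modelFun A B (invPhi (recip z)))⁻¹) n (-Q) P := by
  obtain ⟨hQ0, hP, hQ, hO⟩ := hPQ
  have hnorm : ∀ᶠ z : ℂ in 𝓝 0, ‖invPhi (recip z)‖ ≤ 1 := by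
    filter_upwards with z
    by_cases hz : z = 0
    · simp [hz, recip, invPhi]
    · have : invPhi (recip z) = (phi z⁻¹)⁻¹ := by simp [recip, hz, invPhi]
      rw [this, norm_inv]
      exact inv_le_one_of_one_le₀ (one_le_norm_phi _)
  have hlow : ∃ c > 0, ∀ w : ℂ, ‖w‖ ≤ 1 → c ≤ ‖modelFun A B w‖ := by
    have hc : ContinuousOn (fun w => ‖modelFun A B w‖) (closedBall 0 1) := fun w hw =>
      (differentiableAt_modelFun hA hB (mem_closedBall_zero_iff.1 hw)).continuousAt.norm
        |>.continuousWithinAt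
    obtain ⟨w, hw, hmin⟩ := (isCompact_closedBall (0 : ℂ) 1).exists_isMinOn ⟨0, by simp⟩ hc
    exact ⟨_, norm_pos_iff.2 (modelFun_ne_zero hA hB (mem_closedBall_zero_iff.1 hw)),
      fun v hv => hmin (mem_closedBall_zero_iff.2 hv)⟩
  obtain ⟨c, hc, hlow⟩ := hlow
  have hO' : (fun z : ℂ => P.eval z * -(modelFun A B (invPhi (recip z)))⁻¹ - (-Q).eval z)
      =O[𝓝 0] fun z : ℂ => z ^ (2 * n + 1) := by
    refine Asymptotics.IsBigO.trans ?_ hO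
    refine Asymptotics.IsBigO.of_bound c⁻¹ ?_
    filter_upwards [hnorm] with z hz
    have h0 := modelFun_ne_zero hA hB hz
    have h1 := hlow _ hz
    set F := modelFun A B (invPhi (recip z))
    have : P.eval z * -F⁻¹ - (-Q).eval z = F⁻¹ * (Q.eval z * F - P.eval z) := by
      rw [Polynomial.eval_neg]
      field_simp
      ring
    rw [this, norm_mul, norm_inv]
    gcongr
  refine ⟨?_, by rwa [Polynomial.natDegree_neg], hP, hO'⟩
  rintro rfl
  refine hQ0 ?_
  -- A zero numerator would make `Q` vanish to order `2n + 1` although its degree is at most `n`;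
  -- the reflected limit at infinity then forces `Q = 0`.
  have hq : (fun z : ℂ => Q.eval z) =O[𝓝 0] fun z : ℂ => z ^ (2 * n + 1) := by
    simpa using hO'
  have hrefl : Q.reflect n = 0 := by
    have ht := IsPadePair.tendsto (f := fun _ => 1) (n := n) (P := 0) (Q := Q)
    refine eq_zero_of_tendsto_eval ?_
    have ht := ht ⟨hQ0, by simp, hQ, by simpa using hq⟩
    have hinv : Tendsto (fun z : ℂ => (z⁻¹) ^ n) (Bornology.cobounded ℂ) (𝓝 (0 ^ n)) :=
      (tendsto_inv₀_cobounded (α := ℂ)).pow n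
    have := hinv.mul ht
    rw [mul_zero] at this
    refine this.congr' ?_
    filter_upwards [tendsto_norm_cobounded_atTop.eventually (eventually_gt_atTop (0 : ℝ))] with z hz
    have hz0 : z ≠ 0 := norm_pos_iff.1 hz
    rw [Polynomial.reflect_zero, Polynomial.eval_zero, mul_one, sub_zero, inv_pow,
      inv_mul_cancel_left₀ (pow_ne_zero n hz0)]
  exact Polynomial.reflect_eq_zero_iff.1 hrefl

/-- Zero distribution of the reflected Padé denominators. -/
theorem weakStarTendsto_denominators {F : ℂ → ℂ} {k : ℂ → ℝ} (h : HasPositiveJump F k)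
    {P Q : ℕ → ℂ[X]} (hPQ : ∀ n, IsPadePair (fun z => F (invPhi (recip z))) n (P n) (Q n)) :
    WeakStarTendsto (fun n => (n : ENNReal)⁻¹ • zeroCount ((Q n).reflect n)) arcsine := by
  obtain ⟨C, hC, hb⟩ := exists_norm_joukProd_le h.continuousOn h.pos
  refine weakStarTendsto_zeroCount (fun n => ?_) (fun n η hη => ?_) hC fun n w hw => ?_
  · rw [← (IsAlgClosed.splits _).natDegree_eq_card_roots]
    exact ((hPQ n).isOrthogonal h).natDegree_eq h.continuousOn h.pos
  · exact ((hPQ n).isOrthogonal h).mem_E_of_mem_roots h.continuousOn h.pos hη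
  · exact hb n _ ((hPQ n).isOrthogonal h) w hw

end PadeModel
end

/-! ### Assembly of the main theorem. -/

theorem theorem1 (A B : ℝ) (hA : 1 < A) (hAB : A < B) (P Q p q : ℕ → Polynomial ℂ)
    (hPQ : ∀ n, PadeModel.IsPadePair (PadeModel.germ A B) n (P n) (Q n))
    -- `p_n(ζ) = ζⁿ P_n(1/ζ)` and `q_n(ζ) = ζⁿ Q_n(1/ζ)`
    (hp : ∀ n, p n = Polynomial.reflect n (P n))
    (hq : ∀ n, q n = Polynomial.reflect n (Q n)) :
    -- the arcsine measure and `log |φ|` are the Robin measure of `E` and Green's function of `D`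
    (∃ γ : ℝ, PadeModel.IsRobinMeasure PadeModel.E PadeModel.arcsine γ ∧
      PadeModel.IsGreenFunction PadeModel.E PadeModel.green γ) ∧
    -- limit distribution of the zeros
    PadeModel.WeakStarTendsto
      (fun n => (n : ENNReal)⁻¹ • PadeModel.zeroCount (p n)) PadeModel.arcsine ∧
    PadeModel.WeakStarTendsto
      (fun n => (n : ENNReal)⁻¹ • PadeModel.zeroCount (q n)) PadeModel.arcsine ∧
    -- rate of convergence, uniformly on the compact subsets of `D`
    (∀ K : Set (OnePoint ℂ), IsCompact K → K ⊆ PadeModel.D →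
      (∀ᶠ n in Filter.atTop, ∀ ζ ∈ K, (Q n).eval (PadeModel.coord ζ) ≠ 0) ∧
      TendstoUniformlyOn
        (fun (n : ℕ) (ζ : OnePoint ℂ) =>
          ‖PadeModel.fStar A B ζ -
            (P n).eval (PadeModel.coord ζ) / (Q n).eval (PadeModel.coord ζ)‖
              ^ (1 / (2 * (n : ℝ) + 1)))
        PadeModel.expNegGreen Filter.atTop K) ∧
    (∀ ζ ∈ PadeModel.D, PadeModel.expNegGreen ζ < 1) := by
  open PadeModel in
  have hB : 1 < B := hA.trans hAB
  have hF := hasPositiveJump_modelFun hA hB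
  -- The germ is definitionally the model function composed with `1/φ(1/z)`.
  have hPQ' : ∀ n, IsPadePair (fun z => modelFun A B (invPhi (recip z))) n (P n) (Q n) := hPQ
  obtain rfl : p = fun n => Polynomial.reflect n (P n) := funext hp
  obtain rfl : q = fun n => Polynomial.reflect n (Q n) := funext hq
  refine ⟨⟨_, isRobinMeasure_arcsine, isGreenFunction_green⟩,
    weakStarTendsto_denominators (hasPositiveJump_neg_inv hA hB)
      fun n => (hPQ' n).neg_inv hA hB,
    weakStarTendsto_denominators hF hPQ', fun K hK hKD => ⟨?_, ?_⟩, fun ζ hζ => ?_⟩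
  -- The denominators are free of zeros on `D` for every `n`, not only for large `n`.
  · exact Filter.Eventually.of_forall fun n ζ hζ => (hPQ' n).eval_coord_ne_zero hF (hKD hζ)
  · obtain ⟨r, hr0, hr1, hKr⟩ := exists_norm_invPhi_le hK hKD
    obtain ⟨c, hc, C, hC, hb⟩ := exists_remainder_bounds hF hr0 hr1
    have hfun : expNegGreen = fun ζ => ‖invPhi ζ‖ := funext expNegGreen_eq
    rw [hfun]
    exact tendstoUniformlyOn_rpow hc hC (fun ζ _ => norm_nonneg _)
      (fun ζ hζ => (norm_invPhi_lt_one (hKD hζ)).le)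
      (fun n ζ hζ => (hb n (P n) (Q n) (hPQ' n) ζ (hKD hζ) (hKr ζ hζ)).1)
      (fun n ζ hζ => (hb n (P n) (Q n) (hPQ' n) ζ (hKD hζ) (hKr ζ hζ)).2)
  · rw [expNegGreen_eq]
    exact norm_invPhi_lt_one hζ
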